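/- Let $K$ be an arbitrary field, $E$ a finite-dimensional $K$-vector space, $u$ an endomorphism of $E$, and $\alpha,\beta\in K\setminus\{0\}$ with $\alpha\neq\beta$ and $\alpha\neq-\beta$. For $\lambda\in K$ and $k\geq 1$ put $$n_k(u,\lambda):=\dim\operatorname{Ker}(u-\lambda\,\mathrm{id}_E)^k-\dim\operatorname{Ker}(u-\lambda\,\mathrm{id}_E)^{k-1}.$$ Call two sequences $(a_k)_{k\geq1}$ and $(b_k)_{k\geq1}$ of integers intertwined when $a_{k+1}\leq b_k$ and $b_{k+1}\leq a_k$ for every $k\geq 1$. For $\Lambda\subseteq K$, write the minimal polynomial of $u$ as $PQ$ with $P$ and $Q$ monic, $P$ a product of factors $X-\lambda$ with $\lambda\in\Lambda$, and $Q$ without root in $\Lambda$, and let $u_{-\Lambda}$ be the endomorphism of $\operatorname{Ker}Q(u)$ induced by $u$. The elementary factors of an endomorphism $v$ of a finite-dimensional space $F$ are its invariant factors, i.e. the nonconstant monic polynomials $P_1\mid P_2\mid\cdots\mid P_N$ such that $F$, as a $K[X]$-module through $v$, is isomorphic to $\prod_{i=1}^N K[X]/(P_i)$. Then there exist idempotent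 endomorphisms $p,q$ of $E$ with $u=\alpha p+\beta q$ if and only if all the following conditions hold: (i) the sequences $(n_k(u,0))_{k\geq1}$ and $(n_k(u,\alpha+\beta))_{k\geq1}$ are intertwined; (ii) the sequences $(n_k(u,\alpha))_{k\geq1}$ and $(n_k(u,\beta))_{k\geq1}$ are intertwined; (iii) each elementary factor of $u_{-\{0,\alpha,\beta,\alpha+\beta\}}$ is of the form $R\bigl((X-\alpha)(X-\beta)\bigr)$ with $R\in K[X]$. -/

import Mathlib

open Polynomial

namespace IdemComb

/-- `x` is an `(α, β)`-composite: `x = α p + β q` for two idempotents `p`, `q`. -/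
def IsComposite {K A : Type*} [Field K] [Ring A] [Algebra K A] (α β : K) (x : A) : Prop :=
  ∃ p q : A, IsIdempotentElem p ∧ IsIdempotentElem q ∧ x = α • p + β • q

/-- `nker u l k = dim Ker (u - l)^k - dim Ker (u - l)^(k-1)`, meant for `k ≥ 1`: the number of
Jordan blocks of `u` of size at least `k` for the eigenvalue `l`. -/
noncomputable def nker {K E : Type*} [Field K] [AddCommGroup E] [Module K E]
    (u : Module.End K E) (l : K) (k : ℕ) : ℤ :=
  (Module.finrank K (LinearMap.ker ((u - algebraMap K (Module.End K E) l) ^ k)) : ℤ)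
    - (Module.finrank K (LinearMap.ker ((u - algebraMap K (Module.End K E) l) ^ (k - 1))) : ℤ)

/-- Two sequences indexed by `k ≥ 1` are intertwined. -/
def Intertwined (a b : ℕ → ℤ) : Prop :=
  ∀ k : ℕ, 1 ≤ k → a (k + 1) ≤ b k ∧ b (k + 1) ≤ a k

open Classical in
/-- The factor of `f` with its roots in `S`: the product of the `X - l`, where `l` runs over the
roots of `f` that belong to `S`, counted with multiplicity. -/
noncomputable def partIn {K : Type*} [Field K] (S : Set K) (f : K[X]) : K[X] :=
  ((f.roots.filter (fun l => l ∈ S)).map (fun l => X - C l)).prod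

/-- The cofactor of `partIn S f` in `f` (see `partIn_mul_partOff`); it has no root in `S`. -/
noncomputable def partOff {K : Type*} [Field K] (S : Set K) (f : K[X]) : K[X] :=
  f /ₘ partIn S f

theorem partIn_monic {K : Type*} [Field K] (S : Set K) (f : K[X]) : (partIn S f).Monic :=
  monic_multiset_prod_of_monic _ _ fun l _ => monic_X_sub_C l

theorem partIn_mul_partOff {K : Type*} [Field K] (S : Set K) (f : K[X]) :
    partIn S f * partOff S f = f := by
  classical
  have hd : partIn S f ∣ f := by
    refine dvd_trans ?_ (prod_multiset_X_sub_C_dvd f)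
    exact Multiset.prod_dvd_prod_of_le (Multiset.map_le_map (Multiset.filter_le _ _))
  have h := modByMonic_add_div f (partIn S f)
  rwa [(modByMonic_eq_zero_iff_dvd (partIn_monic S f)).2 hd, zero_add] at h

/-- The subspace `Ker Q(u)`, where `Q` is the factor of the minimal polynomial of `u` without
roots in `S`. -/
noncomputable def kerOff {K E : Type*} [Field K] [AddCommGroup E] [Module K E]
    (u : Module.End K E) (S : Set K) : Submodule K E :=
  LinearMap.ker (aeval u (partOff S (minpoly K u)))

theorem apply_mem_kerOff {K E : Type*} [Field K] [AddCommGroup E] [Module K E]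
    (u : Module.End K E) (S : Set K) : ∀ x ∈ kerOff u S, u x ∈ kerOff u S := by
  intro x hx
  have hc : Commute (aeval u (partOff S (minpoly K u))) u := by
    simpa using ((Commute.all (partOff S (minpoly K u)) X).map (aeval u))
  rw [kerOff, LinearMap.mem_ker] at hx ⊢
  rw [← Module.End.mul_apply, hc.eq, Module.End.mul_apply, hx, map_zero]

/-- The endomorphism `u_{-S}`: the restriction of `u` to `kerOff u S`. -/
noncomputable def restrictOff {K E : Type*} [Field K] [AddCommGroup E] [Module K E]
    (u : Module.End K E) (S : Set K) : Module.End K (kerOff u S) :=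
  u.restrict (apply_mem_kerOff u S)

/-- `P 0, …, P (N - 1)` is the sequence of the elementary factors (invariant factors) of `u`:
nonconstant monic polynomials, each dividing the next, such that `E`, as a `K[X]`-module
through `u`, is isomorphic to the product of the cyclic modules `K[X] / (P i)`; equivalently,
`u` is represented by the block-diagonal matrix of the companion matrices of the `P i`. Every
endomorphism of a finite-dimensional space has exactly one such sequence. -/
structure IsElementaryFactors {K E : Type*} [Field K] [AddCommGroup E] [Module K E]
    (u : Module.End K E) {N : ℕ} (P : Fin N → K[X]) : Prop where
  monic : ∀ i, (P i).Monic
  natDegree_pos : ∀ i, 0 < (P i).natDegree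
  dvd : ∀ i j, i ≤ j → P i ∣ P j
  equiv : Nonempty (Module.AEval' u ≃ₗ[K[X]] ((i : Fin N) → K[X] ⧸ Ideal.span {P i}))

/-- `P` is a polynomial of `Y`, i.e. `P = Q(Y)` for some polynomial `Q`. -/
def IsPolynomialOf {K : Type*} [Field K] (Y P : K[X]) : Prop :=
  ∃ Q : K[X], P = Q.comp Y

end IdemComb

/-! Rescaling the idempotents, `u = a + b` with `a² = αa` and `b² = βb`. Put `d = α + β`, `v = u -
d` and `Y = (X - α)(X - β)`. The reflection `X ↦ d - X` swaps 0 with `d` and `α` with `β`, and it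
fixes `Y`; correspondingly `Y(u) = uv + αβ` commutes with `a` and `b`, although `u` need not.

Necessity rests on the commutator `z = ab - ba`, for which `zu = -vz`, `zv = -uz` and `z² = uv(u -
α)(u - β)`. Thus `z` exchanges the generalized eigenspaces of `u` for 0 and `d`, and there `z²` is
`u`, respectively `v`, times an injective factor; comparing the kernels of successive powers of `z`
intertwines the block counts (`finrank_ker_pow_le`). Replacing `p` by `1 - p` turns the pair `α, β`
into the pair already treated. Away from the four eigenvalues `z` is injective and exchanges `ker a`
and `range a`; a cyclic decomposition of `range a` under `Y(u)` with polynomials `R i` then yields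
one of the whole space under `u` with polynomials `(R i)(Y)`.

For sufficiency, the conditions split the space into cyclic modules `K[X]/(R)` and `K[X]/(R (X -
c))`, with `R` fixed by the reflection and `c` one of the four eigenvalues. On each of them `a` is
written explicitly with the twisted divided difference (`isCompositeModule_quotient_of_reflection`).
-/

namespace IdemComb

/-! ### Cyclic decompositions and invariant factors of K[X]-modules -/

section CyclicDecomposition

variable {K M ι : Type*} [Field K] [AddCommGroup M] [Module K M] [Module K[X] M]
  [IsScalarTower K K[X] M] [Fintype ι]

/-- The `x i` generate cyclic submodules `K[X] / (P i)` of which `M` is the direct sum. -/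
structure IsCyclicDecomp (x : ι → M) (P : ι → K[X]) : Prop where
  monic : ∀ i, (P i).Monic
  smul_eq_zero : ∀ i, P i • x i = 0
  span_eq_top : Submodule.span K[X] (Set.range x) = ⊤
  sum_natDegree : ∑ i, (P i).natDegree = Module.finrank K M

theorem finrank_pi_quotient {P : ι → K[X]} (hP : ∀ i, (P i).Monic) :
    Module.finrank K ((i : ι) → K[X] ⧸ Ideal.span {P i}) = ∑ i, (P i).natDegree := by
  have : ∀ i, Module.Finite K (K[X] ⧸ Ideal.span {P i}) := fun i => (hP i).finite_quotient
  rw [Module.finrank_pi_fintype]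
  exact Finset.sum_congr rfl fun i _ => finrank_quotient_span_eq_natDegree

/-- The degree sum replaces linear independence: the canonical map from the product of the quotients
is onto, and equal dimensions make it bijective. -/
theorem IsCyclicDecomp.nonempty_equiv [FiniteDimensional K M] {x : ι → M} {P : ι → K[X]}
    (h : IsCyclicDecomp x P) :
    Nonempty (M ≃ₗ[K[X]] ((i : ι) → K[X] ⧸ Ideal.span {P i})) := by
  classical
  have : ∀ i, Module.Finite K (K[X] ⧸ Ideal.span {P i}) := fun i => (h.monic i).finite_quotient
  let g : (i : ι) → (K[X] ⧸ Ideal.span {P i}) →ₗ[K[X]] M := fun i =>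
    Submodule.liftQSpanSingleton (P i) (LinearMap.toSpanSingleton K[X] M (x i))
      (h.smul_eq_zero i)
  let φ : ((i : ι) → K[X] ⧸ Ideal.span {P i}) →ₗ[K[X]] M := LinearMap.lsum K[X] _ K[X] g
  have hφ : ∀ i, φ (Pi.single i (Submodule.Quotient.mk 1)) = x i := fun i => by
    simp only [φ, LinearMap.lsum_piSingle]
    change (1 : K[X]) • x i = x i
    exact one_smul _ _
  have hsurj : Function.Surjective φ := by
    rw [← LinearMap.range_eq_top, eq_top_iff, ← h.span_eq_top, Submodule.span_le]
    rintro _ ⟨i, rfl⟩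
    exact ⟨_, hφ i⟩
  have hinj : Function.Injective φ := by
    have := LinearMap.injective_iff_surjective_of_finrank_eq_finrank (K := K)
      (f := φ.restrictScalars K) (by rw [finrank_pi_quotient h.monic, h.sum_natDegree])
    exact this.2 hsurj
  exact ⟨(LinearEquiv.ofBijective φ ⟨hinj, hsurj⟩).symm⟩

theorem exists_isCyclicDecomp_of_equiv {P : ι → K[X]} (hP : ∀ i, (P i).Monic)
    (e : M ≃ₗ[K[X]] ((i : ι) → K[X] ⧸ Ideal.span {P i})) :
    ∃ x : ι → M, IsCyclicDecomp x P := by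
  classical
  refine ⟨fun i => e.symm (Pi.single i (Submodule.Quotient.mk 1)), hP, fun i => ?_, ?_, ?_⟩
  · rw [← map_smul, ← Pi.single_smul, ← Submodule.Quotient.mk_smul, smul_eq_mul, mul_one,
      (Submodule.Quotient.mk_eq_zero _).2 (Ideal.mem_span_singleton_self _), Pi.single_zero,
      map_zero]
  · rw [eq_top_iff]
    rintro m -
    obtain ⟨y, rfl⟩ := e.symm.surjective m
    rw [← Finset.univ_sum_single y, map_sum]
    refine Submodule.sum_mem _ fun i _ => ?_
    obtain ⟨f, hf⟩ := Submodule.Quotient.mk_surjective _ (y i)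
    have : Pi.single i (y i) = f • (Pi.single i (Submodule.Quotient.mk 1) :
        (i : ι) → K[X] ⧸ Ideal.span {P i}) := by
      rw [← Pi.single_smul, ← Submodule.Quotient.mk_smul, smul_eq_mul, mul_one, hf]
    rw [this, map_smul]
    exact Submodule.smul_mem _ _ (Submodule.subset_span ⟨i, rfl⟩)
  · rw [← finrank_pi_quotient hP]
    exact ((e.restrictScalars K).finrank_eq).symm

theorem isTorsion_of_finiteDimensional [FiniteDimensional K M] : Module.IsTorsion K[X] M := by
  intro m
  by_contra hm
  push Not at hm
  have hinj : Function.Injective ((LinearMap.toSpanSingleton K[X] M m).restrictScalars K) := by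
    rw [← LinearMap.ker_eq_bot, LinearMap.ker_eq_bot']
    intro f hf
    by_contra hne
    exact hm ⟨f, mem_nonZeroDivisors_of_ne_zero hne⟩ hf
  have := Module.Finite.of_injective _ hinj
  exact Polynomial.not_finite this

theorem exists_isCyclicDecomp [FiniteDimensional K M] :
    ∃ (N : ℕ) (x : Fin N → M) (P : Fin N → K[X]), IsCyclicDecomp x P := by
  classical
  have : Module.Finite K[X] M := Module.Finite.of_restrictScalars_finite K K[X] M
  obtain ⟨ι, _, p, hp, e, ⟨E⟩⟩ :=
    Module.equiv_directSum_of_isTorsion (isTorsion_of_finiteDimensional (K := K) (M := M))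
  let σ := (Fintype.equivFin ι).symm
  let P : Fin (Fintype.card ι) → K[X] := fun i => normalize (p (σ i) ^ e (σ i))
  have hspan : ∀ i, Submodule.span K[X] {p i ^ e i} = Ideal.span {normalize (p i ^ e i)} :=
    fun i => Ideal.span_singleton_eq_span_singleton.2 (associated_normalize _)
  have E' : M ≃ₗ[K[X]] ((i : Fin (Fintype.card ι)) → K[X] ⧸ Ideal.span {P i}) :=
    E.trans ((DirectSum.linearEquivFunOnFintype K[X] ι _).trans
      ((LinearEquiv.piCongrRight fun i => Submodule.quotEquivOfEq _ _ (hspan i)).trans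
        (LinearEquiv.piCongrLeft K[X] (fun i => K[X] ⧸ Ideal.span {normalize (p i ^ e i)})
          σ).symm))
  obtain ⟨x, hx⟩ := exists_isCyclicDecomp_of_equiv
    (fun i => monic_normalize (pow_ne_zero _ (hp (σ i)).ne_zero)) E'
  exact ⟨_, x, P, hx⟩

omit [IsScalarTower K K[X] M] in
/-- Two summands `K[X] / (P i)`, `K[X] / (P j)` may be replaced by the summands of the gcd and
of the lcm. -/
theorem IsCyclicDecomp.gcd_lcm {N : ℕ} {x : Fin N → M} {P : Fin N → K[X]}
    (h : IsCyclicDecomp x P) {i j : Fin N} (hij : i ≠ j) :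
    ∃ (x' : Fin N → M) (g l : K[X]), g ∣ P i ∧ g ∣ P j ∧ g * l = P i * P j ∧
      IsCyclicDecomp x' (Function.update (Function.update P i g) j l) := by
  classical
  let g := gcd (P i) (P j)
  have hg0 : g ≠ 0 := fun h0 => (h.monic i).ne_zero ((gcd_eq_zero_iff _ _).1 h0).1
  have hgm : g.Monic := by
    have := monic_normalize hg0
    rwa [normalize_gcd] at this
  have hgb : ∃ s t, g = P i * s + P j * t := by
    obtain ⟨s, t, hst⟩ := exists_gcd_eq_mul_add_mul (P i) (P j)
    exact ⟨s, t, hst⟩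
  obtain ⟨a, ha⟩ : g ∣ P i := gcd_dvd_left _ _
  obtain ⟨b, hb⟩ : g ∣ P j := gcd_dvd_right _ _
  obtain ⟨s, t, hst⟩ : IsCoprime a b := by
    obtain ⟨s, t, hst⟩ := exists_gcd_eq_mul_add_mul (P i) (P j)
    refine ⟨s, t, mul_left_cancel₀ hg0 ?_⟩
    change g = _ at hst
    rw [ha, hb] at hst
    rw [mul_one]
    conv_rhs => rw [hst]
    ring
  have ham : a.Monic := hgm.of_mul_monic_left (ha ▸ h.monic i)
  have hbm : b.Monic := hgm.of_mul_monic_left (hb ▸ h.monic j)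
  -- Since `s * a + t * b = 1`, this change of generators is invertible: `x i = y + (t * b) • z` and
  -- `x j = z - x i`.
  let y := (s * a) • x i - (t * b) • x j
  let z := x i + x j
  obtain ⟨x', hxi, hxj, hxk⟩ : ∃ x' : Fin N → M, x' i = y ∧ x' j = z ∧
      ∀ k, k ≠ i → k ≠ j → x' k = x k :=
    ⟨Function.update (Function.update x i y) j z, by simp [hij], by simp,
      fun k h1 h2 => by simp [h1, h2]⟩
  have hPi : P i • x i = 0 := h.smul_eq_zero i
  have hPj : P j • x j = 0 := h.smul_eq_zero j
  have hy : g • y = 0 := by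
    have : g • y = s • (P i • x i) - t • (P j • x j) := by
      rw [ha, hb]
      simp only [y, smul_sub, smul_smul]
      rw [mul_left_comm g, mul_left_comm g]
    rw [this, hPi, hPj, smul_zero, smul_zero, sub_zero]
  have hz : (g * a * b) • z = 0 := by
    have : (g * a * b) • z = b • (P i • x i) + a • (P j • x j) := by
      rw [ha, hb]
      simp only [z, smul_add, smul_smul]
      rw [mul_comm b, mul_left_comm a, mul_assoc]
    rw [this, hPi, hPj, smul_zero, smul_zero, add_zero]
  refine ⟨x', g, g * a * b, ⟨a, ha⟩, ⟨b, hb⟩, by rw [ha, hb]; ring, fun k => ?_, fun k => ?_, ?_,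
    ?_⟩
  · rcases eq_or_ne k j with rfl | hkj
    · simpa using (hgm.mul ham).mul hbm
    · rcases eq_or_ne k i with rfl | hki
      · simpa [hkj] using hgm
      · simpa [hkj, hki] using h.monic k
  · rcases eq_or_ne k j with rfl | hkj
    · rw [hxj]; simpa using hz
    · rcases eq_or_ne k i with rfl | hki
      · rw [hxi]; simpa [hkj] using hy
      · simpa [hxk k hki hkj, hkj, hki] using h.smul_eq_zero k
  · rw [eq_top_iff, ← h.span_eq_top, Submodule.span_le]
    have hmem : ∀ k, x' k ∈ Submodule.span K[X] (Set.range x') :=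
      fun k => Submodule.subset_span ⟨k, rfl⟩
    have hi : x i ∈ Submodule.span K[X] (Set.range x') := by
      have : x i = (t * b) • x' j + x' i := by
        rw [hxi, hxj]
        simp only [y, z, smul_add]
        calc x i = (s * a + t * b) • x i := by rw [hst, one_smul]
          _ = _ := by rw [add_smul]; abel
      rw [this]
      exact Submodule.add_mem _ (Submodule.smul_mem _ _ (hmem j)) (hmem i)
    rintro _ ⟨k, rfl⟩
    rcases eq_or_ne k j with rfl | hkj
    · have : x k = x' k - x i := by rw [hxj]; simp [z]
      rw [this]
      exact Submodule.sub_mem _ (hmem k) hi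
    · rcases eq_or_ne k i with rfl | hki
      · exact hi
      · simpa [hxk k hki hkj] using hmem k
  · rw [← h.sum_natDegree, ← Finset.add_sum_erase _ _ (Finset.mem_univ j),
      ← Finset.add_sum_erase _ (fun k => (P k).natDegree) (Finset.mem_univ j),
      ← Finset.add_sum_erase (Finset.univ.erase j) _ (Finset.mem_erase.2 ⟨hij, Finset.mem_univ i⟩),
      ← Finset.add_sum_erase (Finset.univ.erase j) (fun k => (P k).natDegree)
        (Finset.mem_erase.2 ⟨hij, Finset.mem_univ i⟩), ← add_assoc, ← add_assoc]
    congr 1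
    · simp only [Function.update_self, Function.update_of_ne hij]
      rw [(hgm.mul ham).natDegree_mul hbm, hgm.natDegree_mul ham, ha, hb, hgm.natDegree_mul ham,
        hgm.natDegree_mul hbm]
      ring
    · refine Finset.sum_congr rfl fun k hk => ?_
      have h1 : k ≠ i := Finset.ne_of_mem_erase hk
      have h2 : k ≠ j := Finset.ne_of_mem_erase (Finset.mem_of_mem_erase hk)
      simp [h1, h2]

/-- Existence of the invariant factors. -/
theorem exists_isCyclicDecomp_dvd [FiniteDimensional K M] :
    ∃ (N : ℕ) (x : Fin N → M) (P : Fin N → K[X]), IsCyclicDecomp x P ∧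
      (∀ i, 0 < (P i).natDegree) ∧ ∀ i j, i ≤ j → P i ∣ P j := by
  classical
  have hex := exists_isCyclicDecomp (K := K) (M := M)
  let N := Nat.find hex
  have hN : ∃ (x : Fin N → M) (P : Fin N → K[X]), IsCyclicDecomp x P := Nat.find_spec hex
  -- Among the decompositions with the fewest summands, one of maximal weight is taken. If `P i ∤ P
  -- j` with `i < j`, passing to the gcd and the lcm would raise the weight by `(j - i) * (deg (P i)
  -- - deg g) > 0`.
  let wt : (Fin N → K[X]) → ℕ := fun P => ∑ i : Fin N, (i : ℕ) * (P i).natDegree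
  let p : ℕ → Prop := fun n =>
    ∃ (x : Fin N → M) (P : Fin N → K[X]), IsCyclicDecomp x P ∧ wt P = n
  have hbound : ∀ n, p n → n ≤ N * Module.finrank K M := by
    rintro n ⟨x, P, h, rfl⟩
    rw [← h.sum_natDegree, Finset.mul_sum]
    exact Finset.sum_le_sum fun i _ => Nat.mul_le_mul_right _ i.2.le
  obtain ⟨x₀, P₀, h₀⟩ := hN
  have hmax := Nat.findGreatest_spec (P := p) (hbound _ ⟨x₀, P₀, h₀, rfl⟩) ⟨x₀, P₀, h₀, rfl⟩
  obtain ⟨x, P, h, hw⟩ := hmax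
  refine ⟨N, x, P, h, fun i => ?_, fun i j hij => ?_⟩
  · by_contra hi
    -- A summand with `P i = 1` is zero; dropping it contradicts the minimality of `N`.
    have hP : P i = 1 := (h.monic i).natDegree_eq_zero.1 (by omega)
    have hx : x i = 0 := by simpa [hP] using h.smul_eq_zero i
    have hNpos : 0 < N := i.pos
    obtain ⟨n, hn⟩ : ∃ n, N = n + 1 := ⟨N - 1, by omega⟩
    refine Nat.find_min hex (m := n) (by change n < N; omega) ?_
    clear_value N
    subst hn
    refine ⟨x ∘ i.succAbove, P ∘ i.succAbove, fun k => h.monic _, fun k => h.smul_eq_zero _, ?_,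
      ?_⟩
    · rw [eq_top_iff, ← h.span_eq_top, Submodule.span_le]
      rintro _ ⟨k, rfl⟩
      rcases eq_or_ne k i with rfl | hk
      · rw [hx]; exact Submodule.zero_mem _
      · obtain ⟨l, rfl⟩ := Fin.exists_succAbove_eq hk
        exact Submodule.subset_span ⟨l, rfl⟩
    · rw [← h.sum_natDegree, Fin.sum_univ_succAbove _ i, hP]
      simp
  · rcases hij.eq_or_lt with rfl | hlt
    · exact dvd_rfl
    by_contra hnd
    obtain ⟨x', g, l, hgi, hgj, hgl, h'⟩ := h.gcd_lcm hlt.ne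
    have hgm : g.Monic := by
      have := h'.monic i
      simpa [hlt.ne] using this
    have hlm : l.Monic := by
      have := h'.monic j
      simpa using this
    have hdeg : g.natDegree < (P i).natDegree := by
      refine lt_of_le_of_ne (natDegree_le_of_dvd hgi (h.monic i).ne_zero) fun he => hnd ?_
      rwa [← eq_of_monic_of_dvd_of_natDegree_le hgm (h.monic i) hgi he.ge] at hgj
    have hsum : g.natDegree + l.natDegree = (P i).natDegree + (P j).natDegree := by
      rw [← hgm.natDegree_mul hlm, hgl, (h.monic i).natDegree_mul (h.monic j)]
    have hp' : p (wt (Function.update (Function.update P i g) j l)) := ⟨x', _, h', rfl⟩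
    have hle := Nat.le_findGreatest (hbound _ hp') hp'
    rw [← hw] at hle
    refine absurd hle (not_le.2 ?_)
    simp only [wt]
    rw [← Finset.add_sum_erase _ _ (Finset.mem_univ j),
      ← Finset.add_sum_erase _ (fun k : Fin N => (k : ℕ) * (Function.update (Function.update P i g) j l
        k).natDegree) (Finset.mem_univ j),
      ← Finset.add_sum_erase (Finset.univ.erase j) _
        (Finset.mem_erase.2 ⟨hlt.ne, Finset.mem_univ i⟩),
      ← Finset.add_sum_erase (Finset.univ.erase j) (fun k : Fin N => (k : ℕ) * (Function.update
        (Function.update P i g) j l k).natDegree)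
        (Finset.mem_erase.2 ⟨hlt.ne, Finset.mem_univ i⟩), ← add_assoc, ← add_assoc]
    refine add_lt_add_of_lt_of_le ?_ (le_of_eq ?_)
    · simp only [Function.update_self, Function.update_of_ne hlt.ne]
      have hlt' : (i : ℕ) < j := hlt
      zify at *
      nlinarith
    · refine Finset.sum_congr rfl fun k hk => ?_
      have h1 : k ≠ i := Finset.ne_of_mem_erase hk
      have h2 : k ≠ j := Finset.ne_of_mem_erase (Finset.mem_of_mem_erase hk)
      simp [h1, h2]

end CyclicDecomposition

/-! ### Composites: transport, products, quotients -/

section Composite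

variable {K : Type*} [Field K] {α β : K}

theorem isComposite_iff {A : Type*} [Ring A] [Algebra K A] (hα : α ≠ 0) (hβ : β ≠ 0) {u : A} :
    IsComposite α β u ↔ ∃ a b : A, a * a = α • a ∧ b * b = β • b ∧ u = a + b := by
  constructor
  · rintro ⟨p, q, hp, hq, rfl⟩
    refine ⟨α • p, β • q, ?_, ?_, rfl⟩
    · rw [smul_mul_smul_comm, hp.eq, mul_smul]
    · rw [smul_mul_smul_comm, hq.eq, mul_smul]
  · rintro ⟨a, b, ha, hb, rfl⟩
    refine ⟨α⁻¹ • a, β⁻¹ • b, ?_, ?_, ?_⟩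
    · rw [IsIdempotentElem, smul_mul_smul_comm, ha, smul_smul, mul_assoc, inv_mul_cancel₀ hα,
        mul_one]
    · rw [IsIdempotentElem, smul_mul_smul_comm, hb, smul_smul, mul_assoc, inv_mul_cancel₀ hβ,
        mul_one]
    · rw [smul_inv_smul₀ hα, smul_inv_smul₀ hβ]

theorem IsComposite.sub_algebraMap {A : Type*} [Ring A] [Algebra K A] {u : A}
    (h : IsComposite α β u) : IsComposite (-α) β (u - algebraMap K A α) := by
  obtain ⟨p, q, hp, hq, rfl⟩ := h
  refine ⟨1 - p, q, hp.one_sub, hq, ?_⟩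
  rw [Algebra.algebraMap_eq_smul_one, smul_sub, neg_smul, neg_smul]
  abel

variable {E F : Type*} [AddCommGroup E] [Module K E] [AddCommGroup F] [Module K F]

theorem IsComposite.of_equiv {u : Module.End K E} {v : Module.End K F} (e : E ≃ₗ[K] F)
    (he : ∀ x, e (u x) = v (e x)) (h : IsComposite α β u) : IsComposite α β v := by
  obtain ⟨p, q, hp, hq, rfl⟩ := h
  refine ⟨e.conjAlgEquiv K p, e.conjAlgEquiv K q, hp.map _, hq.map _, ?_⟩
  rw [← map_smul, ← map_smul, ← map_add]
  ext y
  obtain ⟨x, rfl⟩ := e.surjective y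
  rw [← he]
  simp [LinearEquiv.conjAlgEquiv_apply_apply]

theorem IsComposite.prodMap {u : Module.End K E} {v : Module.End K F} (hu : IsComposite α β u)
    (hv : IsComposite α β v) : IsComposite α β (LinearMap.prodMap u v) := by
  obtain ⟨p, q, hp, hq, rfl⟩ := hu
  obtain ⟨p', q', hp', hq', rfl⟩ := hv
  refine ⟨LinearMap.prodMap p p', LinearMap.prodMap q q', ?_, ?_, ?_⟩
  · rw [IsIdempotentElem, LinearMap.prodMap_mul, hp.eq, hp'.eq]
  · rw [IsIdempotentElem, LinearMap.prodMap_mul, hq.eq, hq'.eq]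
  · rw [← LinearMap.prodMap_smul, ← LinearMap.prodMap_smul, LinearMap.prodMap_add]

theorem IsComposite.pi {ι : Type*} {V : ι → Type*} [∀ i, AddCommGroup (V i)]
    [∀ i, Module K (V i)] {u : (i : ι) → Module.End K (V i)} (hu : ∀ i, IsComposite α β (u i)) :
    IsComposite α β (LinearMap.pi fun i => u i ∘ₗ LinearMap.proj i :
      Module.End K ((i : ι) → V i)) := by
  choose p q hp hq h using hu
  refine ⟨LinearMap.pi fun i => p i ∘ₗ LinearMap.proj i,
    LinearMap.pi fun i => q i ∘ₗ LinearMap.proj i, ?_, ?_, ?_⟩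
  · refine LinearMap.ext fun x => funext fun i => ?_
    exact LinearMap.congr_fun (hp i).eq (x i)
  · refine LinearMap.ext fun x => funext fun i => ?_
    exact LinearMap.congr_fun (hq i).eq (x i)
  · refine LinearMap.ext fun x => funext fun i => ?_
    exact LinearMap.congr_fun (h i) (x i)

/-- The kernel of `f` is stable under `u` and `a`, hence under `b = u - a`, so both summands descend
along `f` and keep their quadratic equations. -/
theorem IsComposite.of_surjective (hα : α ≠ 0) (hβ : β ≠ 0) {u a b : Module.End K E}
    {v : Module.End K F} (f : E →ₗ[K] F) (hf : Function.Surjective f)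
    (hfu : ∀ x, f (u x) = v (f x)) (ha : a * a = α • a) (hb : b * b = β • b) (hu : u = a + b)
    (hk : ∀ x, f x = 0 → f (a x) = 0) : IsComposite α β v := by
  have key : ∀ c : Module.End K E, (∀ x, f x = 0 → f (c x) = 0) →
      ∃ d : Module.End K F, ∀ x, d (f x) = f (c x) := by
    intro c hc
    obtain ⟨s, hs⟩ := f.exists_rightInverse_of_surjective (LinearMap.range_eq_top.2 hf)
    refine ⟨f ∘ₗ c ∘ₗ s, fun x => ?_⟩
    have h1 : f (s (f x)) = f x := LinearMap.congr_fun hs (f x)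
    have h2 := hc (s (f x) - x) (by rw [map_sub, h1, sub_self])
    rw [map_sub, map_sub, sub_eq_zero] at h2
    exact h2
  obtain ⟨a', ha'⟩ := key a hk
  obtain ⟨b', hb'⟩ := key b fun x hx => by
    have : b = u - a := by rw [hu]; abel
    rw [this, LinearMap.sub_apply, map_sub, hfu, hx, hk x hx, map_zero, sub_zero]
  refine (isComposite_iff hα hβ).2 ⟨a', b', ?_, ?_, ?_⟩
  · ext y
    obtain ⟨x, rfl⟩ := hf y
    rw [Module.End.mul_apply, ha', ha', ← Module.End.mul_apply, ha, LinearMap.smul_apply,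
      LinearMap.smul_apply, ha', map_smul]
  · ext y
    obtain ⟨x, rfl⟩ := hf y
    rw [Module.End.mul_apply, hb', hb', ← Module.End.mul_apply, hb, LinearMap.smul_apply,
      LinearMap.smul_apply, hb', map_smul]
  · ext y
    obtain ⟨x, rfl⟩ := hf y
    rw [← hfu, hu, LinearMap.add_apply, LinearMap.add_apply, ha', hb', map_add]

/-- Multiplication by `X` on the `K[X]`-module `M` is an `(α, β)`-composite. -/
def IsCompositeModule (α β : K) (M : Type*) [AddCommGroup M] [Module K M] [Module K[X] M]
    [IsScalarTower K K[X] M] : Prop :=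
  IsComposite α β (Algebra.lsmul K K M (X : K[X]))

variable {M N : Type*} [AddCommGroup M] [Module K M] [Module K[X] M] [IsScalarTower K K[X] M]
  [AddCommGroup N] [Module K N] [Module K[X] N] [IsScalarTower K K[X] N]

theorem IsCompositeModule.of_equiv (e : M ≃ₗ[K[X]] N) (h : IsCompositeModule α β M) :
    IsCompositeModule α β N :=
  IsComposite.of_equiv (e.restrictScalars K) (fun x => e.map_smul X x) h

theorem IsCompositeModule.prod (hM : IsCompositeModule α β M) (hN : IsCompositeModule α β N) :
    IsCompositeModule α β (M × N) :=
  IsComposite.of_equiv (LinearEquiv.refl K (M × N)) (fun _ => rfl) (IsComposite.prodMap hM hN)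

theorem IsCompositeModule.pi {ι : Type*} {V : ι → Type*} [∀ i, AddCommGroup (V i)]
    [∀ i, Module K (V i)] [∀ i, Module K[X] (V i)] [∀ i, IsScalarTower K K[X] (V i)]
    (h : ∀ i, IsCompositeModule α β (V i)) : IsCompositeModule α β ((i : ι) → V i) :=
  IsComposite.of_equiv (LinearEquiv.refl K ((i : ι) → V i)) (fun _ => rfl) (IsComposite.pi h)

theorem isCompositeModule_aeval_iff {u : Module.End K E} :
    IsCompositeModule α β (Module.AEval' u) ↔ IsComposite α β u :=
  ⟨fun h => IsComposite.of_equiv (Module.AEval'.of u).symm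
      (fun x => Module.AEval'.of_symm_X_smul u x) h,
    fun h => IsComposite.of_equiv (Module.AEval'.of u)
      (fun x => (Module.AEval'.X_smul_of u x).symm) h⟩

end Composite

/-! ### The reflection and explicit composites on cyclic modules -/

section Reflection

variable {K : Type*} [Field K]

/-- The `K`-algebra endomorphism of `K[X]` that maps `X` to `d - X`. -/
noncomputable def reflection (d : K) : K[X] →ₐ[K] K[X] :=
  aeval (C d - X)

@[simp] theorem reflection_X (d : K) : reflection d X = C d - X := by simp [reflection]

@[simp] theorem reflection_C (d c : K) : reflection d (C c) = C c := by simp [reflection]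

theorem reflection_reflection (d : K) (f : K[X]) : reflection d (reflection d f) = f := by
  have : (reflection d).comp (reflection d) = AlgHom.id K K[X] := by
    ext
    simp
  exact DFunLike.congr_fun this f

theorem dvd_sub_reflection (d : K) (f : K[X]) : 2 * X - C d ∣ f - reflection d f := by
  have h := Polynomial.sub_dvd_eval_sub (X : K[X]) (C d - X) (f.map C)
  rw [eval_map, eval₂_C_X, eval_map] at h
  have h2 : (2 * X - C d : K[X]) = X - (C d - X) := by ring
  rw [h2]
  exact h

/-- The constant coefficient suffices, so characteristic two, where the polynomial is a nonzero
constant, needs no separate treatment. -/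
theorem two_mul_X_sub_C_ne_zero {d : K} (hd : d ≠ 0) : (2 * X - C d : K[X]) ≠ 0 := by
  intro h
  apply hd
  simpa using congrArg (fun p => p.coeff 0) h

/-- The twisted divided difference `f ↦ (f - σ f) / (2 X - d)`, with `σ` the reflection. -/
theorem exists_dividedDiff {d : K} (hd : d ≠ 0) :
    ∃ D : K[X] →ₗ[K] K[X], ∀ f, (2 * X - C d) * D f = f - reflection d f := by
  choose D hD using dvd_sub_reflection d
  have h0 := two_mul_X_sub_C_ne_zero hd
  refine ⟨⟨⟨D, fun f g => mul_left_cancel₀ h0 ?_⟩, fun c f => mul_left_cancel₀ h0 ?_⟩,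
    fun f => (hD f).symm⟩
  · rw [mul_add, ← hD, ← hD, ← hD, map_add]
    ring
  · rw [RingHom.id_apply, mul_smul_comm, ← hD, ← hD, map_smul, smul_sub]

theorem reflection_comp_of_eq {d : K} {Y : K[X]} (hY : reflection d Y = Y) (R : K[X]) :
    reflection d (R.comp Y) = R.comp Y := by
  change (R.comp Y).comp (C d - X) = _
  rw [comp_assoc]
  exact congrArg R.comp hY

/-- A `K`-linear map `a` on `K[X]` that commutes with reflection-invariant polynomials, and
satisfies the equations defining a composite, descends to quotients by suitable ideals. -/
theorem isCompositeModule_quotient {α β : K} (hα : α ≠ 0) (hβ : β ≠ 0) {P : K[X]}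
    (a : Module.End K K[X]) (ha : ∀ f, a (a f) = C α * a f)
    (hb : ∀ f, X * (X * f - a f) - a (X * f - a f) = C β * (X * f - a f))
    (hP : ∀ f, P ∣ a (P * f)) : IsCompositeModule α β (K[X] ⧸ Ideal.span {P}) := by
  let m : Module.End K K[X] := Algebra.lsmul K K K[X] (X : K[X])
  have hm : ∀ f, m f = X * f := fun f => rfl
  obtain ⟨π, hπ, hπm, hπs⟩ : ∃ π : K[X] →ₗ[K] K[X] ⧸ Ideal.span {P}, (∀ f, π f = 0 ↔ P ∣ f) ∧
      (∀ f, π (m f) = Algebra.lsmul K K (K[X] ⧸ Ideal.span {P}) (X : K[X]) (π f)) ∧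
      Function.Surjective π :=
    ⟨(Ideal.Quotient.mkₐ K (Ideal.span {P})).toLinearMap,
      fun f => Ideal.Quotient.eq_zero_iff_dvd P f, fun f => rfl,
      Ideal.Quotient.mkₐ_surjective K _⟩
  refine IsComposite.of_surjective (u := m) (a := a) (b := m - a) hα hβ π hπs hπm ?_ ?_
    (add_sub_cancel a m).symm ?_
  · refine LinearMap.ext fun f => ?_
    rw [Module.End.mul_apply, ha, LinearMap.smul_apply, smul_eq_C_mul]
  · refine LinearMap.ext fun f => ?_
    rw [Module.End.mul_apply, LinearMap.smul_apply, smul_eq_C_mul]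
    simp only [LinearMap.sub_apply, hm]
    exact hb f
  · intro f hf
    rw [hπ] at hf ⊢
    obtain ⟨g, rfl⟩ := hf
    exact hP g

variable {α β : K}

/-- The divided difference `D` commutes with multiplication by `R`, so maps built from `D` and
multiplications preserve the ideal `(R)`. The coefficient of `D` in `a₁` vanishes at `α` and `α +
β`, that in `a₂` at `0` and `β`; this is what preserves `(R * (X - c))` for each of the four `c`. -/
theorem isCompositeModule_quotient_of_reflection (hα : α ≠ 0) (hβ : β ≠ 0) (hd : α + β ≠ 0)
    {R : K[X]} (hR : reflection (α + β) R = R) :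
    IsCompositeModule α β (K[X] ⧸ Ideal.span {R}) ∧
    ∀ c ∈ ({0, α, β, α + β} : Set K),
      IsCompositeModule α β (K[X] ⧸ Ideal.span {R * (X - C c)}) := by
  obtain ⟨D, hD⟩ := exists_dividedDiff hd
  have h0 := two_mul_X_sub_C_ne_zero hd
  have hσ : ∀ f, reflection (α + β) f = f - (2 * X - C (α + β)) * D f := fun f => by
    rw [hD]; ring
  have hσD : ∀ f, reflection (α + β) (D f) = D f := fun f => by
    have h := congrArg (reflection (α + β)) (hD f)
    rw [map_mul, map_sub, map_sub, map_mul, reflection_reflection, reflection_X, reflection_C,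
      map_ofNat] at h
    refine mul_left_cancel₀ h0 ?_
    rw [hD]
    linear_combination -h
  have hDD : ∀ f, D (D f) = 0 := fun f => by
    refine mul_left_cancel₀ h0 ?_
    rw [hD, hσD, sub_self, mul_zero]
  have hDmul : ∀ f g, D (f * g) = D f * g + reflection (α + β) f * D g := fun f g => by
    refine mul_left_cancel₀ h0 ?_
    rw [hD, map_mul, hσ f, hσ g]
    ring
  have hDX : D X = 1 := by
    refine mul_left_cancel₀ h0 ?_
    rw [hD, reflection_X]
    ring
  have hDC : ∀ c, D (C c) = 0 := fun c => by
    refine mul_left_cancel₀ h0 ?_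
    rw [hD, reflection_C, sub_self, mul_zero]
  have hDR : D R = 0 := by
    refine mul_left_cancel₀ h0 ?_
    rw [hD, hR, sub_self, mul_zero]
  have hDRf : ∀ f, D (R * f) = R * D f := fun f => by rw [hDmul, hDR, hR]; ring
  -- Both maps have 1 as an eigenvector, with eigenvalue `α` for `a₁` and 0 for `a₂`. The equation
  -- `b * b = β • b` for `b = X - a` then forces the value at `X`, and linearity over the
  -- polynomials in `(X - α)(X - β)` gives the rest.
  let a₁ : Module.End K K[X] := Algebra.lsmul K K K[X] (C α) +
    Algebra.lsmul K K K[X] ((X - C α) * (X - C (α + β))) * D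
  have ha₁ : ∀ f, a₁ f = C α * f + (X - C α) * (X - C (α + β)) * D f := fun f => rfl
  let a₂ : Module.End K K[X] := Algebra.lsmul K K K[X] (X * (X - C β)) * D
  have ha₂ : ∀ f, a₂ f = X * (X - C β) * D f := fun f => rfl
  have h₁ : ∀ f, a₁ (a₁ f) = C α * a₁ f := fun f => by
    simp only [ha₁, map_add, map_sub, hDmul, hDX, hDC, hDD, reflection_X, reflection_C, map_mul]
    ring
  have h₁' : ∀ f, X * (X * f - a₁ f) - a₁ (X * f - a₁ f) = C β * (X * f - a₁ f) := fun f => by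
    simp only [ha₁, map_add, map_sub, hDmul, hDX, hDC, hDD, reflection_X, reflection_C, map_mul]
    ring
  have h₂ : ∀ f, a₂ (a₂ f) = C α * a₂ f := fun f => by
    simp only [ha₂, map_add, map_sub, hDmul, hDX, hDC, hDD, reflection_X, reflection_C, map_mul]
    ring
  have h₂' : ∀ f, X * (X * f - a₂ f) - a₂ (X * f - a₂ f) = C β * (X * f - a₂ f) := fun f => by
    simp only [ha₂, map_add, map_sub, hDmul, hDX, hDC, hDD, reflection_X, reflection_C, map_mul]
    ring
  refine ⟨isCompositeModule_quotient hα hβ a₁ h₁ h₁' fun f => ?_, ?_⟩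
  · rw [ha₁, hDRf]
    exact ⟨C α * f + (X - C α) * (X - C (α + β)) * D f, by ring⟩
  rintro c (rfl | rfl | rfl | rfl)
  · refine isCompositeModule_quotient hα hβ a₂ h₂ h₂' fun f => ?_
    rw [ha₂, mul_assoc R, hDRf]
    exact ⟨(X - C β) * D ((X - C 0) * f), by rw [C_0]; ring⟩
  · refine isCompositeModule_quotient hα hβ a₁ h₁ h₁' fun f => ?_
    rw [ha₁, mul_assoc R, hDRf]
    exact ⟨C c * f + (X - C (c + β)) * D ((X - C c) * f), by ring⟩
  · refine isCompositeModule_quotient hα hβ a₂ h₂ h₂' fun f => ?_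
    rw [ha₂, mul_assoc R, hDRf]
    exact ⟨X * D ((X - C c) * f), by ring⟩
  · refine isCompositeModule_quotient hα hβ a₁ h₁ h₁' fun f => ?_
    rw [ha₁, mul_assoc R, hDRf]
    exact ⟨C α * f + (X - C α) * D ((X - C (α + β)) * f), by ring⟩

end Reflection

/-! ### Torsion, Jordan block counts and pairing of blocks -/

section Torsion

variable {K : Type*} [Field K] {M N : Type*} [AddCommGroup M] [Module K M] [Module K[X] M]
  [IsScalarTower K K[X] M] [AddCommGroup N] [Module K N] [Module K[X] N] [IsScalarTower K K[X] N]

open Submodule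

theorem finrank_torsionBy_congr (e : M ≃ₗ[K[X]] N) (f : K[X]) :
    Module.finrank K (torsionBy K[X] M f) = Module.finrank K (torsionBy K[X] N f) := by
  refine LinearEquiv.finrank_eq (LinearEquiv.restrictScalars K
    (LinearEquiv.ofSubmodules e (torsionBy K[X] M f) (torsionBy K[X] N f) ?_))
  ext y
  simp only [Submodule.mem_map, mem_torsionBy_iff]
  constructor
  · rintro ⟨x, hx, rfl⟩
    rw [LinearEquiv.coe_coe, ← map_smul, hx, map_zero]
  · intro hy
    refine ⟨e.symm y, ?_, by simp⟩
    rw [← map_smul, hy, map_zero]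

theorem finrank_torsionBy_submodule {V : Submodule K[X] M} {f : K[X]}
    (h : torsionBy K[X] M f ≤ V) :
    Module.finrank K (torsionBy K[X] V f) = Module.finrank K (torsionBy K[X] M f) := by
  refine LinearEquiv.finrank_eq (LinearEquiv.restrictScalars K (LinearEquiv.ofBijective
    ((V.subtype ∘ₗ (torsionBy K[X] V f).subtype).codRestrict (torsionBy K[X] M f) fun x => ?_)
    ⟨fun x y hxy => ?_, fun y => ?_⟩))
  · exact congrArg Subtype.val x.2
  · have h' : ((x : V) : M) = ((y : V) : M) := congrArg (torsionBy K[X] M f).subtype hxy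
    exact Subtype.ext (Subtype.ext h')
  · exact ⟨⟨⟨y.1, h y.2⟩, Subtype.ext y.2⟩, rfl⟩

theorem finrank_torsionBy_pi {ι : Type*} [Fintype ι] {V : ι → Type*} [∀ i, AddCommGroup (V i)]
    [∀ i, Module K (V i)] [∀ i, Module K[X] (V i)] [∀ i, IsScalarTower K K[X] (V i)]
    [∀ i, FiniteDimensional K (V i)] (f : K[X]) :
    Module.finrank K (torsionBy K[X] ((i : ι) → V i) f) =
      ∑ i, Module.finrank K (torsionBy K[X] (V i) f) := by
  have : ∀ i, FiniteDimensional K (torsionBy K[X] (V i) f) := fun i =>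
    Module.Finite.of_injective ((torsionBy K[X] (V i) f).subtype.restrictScalars K)
      Subtype.val_injective
  rw [← Module.finrank_pi_fintype K]
  exact LinearEquiv.finrank_eq
    { toFun := fun x i => ⟨x.1 i, congrFun x.2 i⟩
      invFun := fun y => ⟨fun i => (y i).1, funext fun i => (y i).2⟩
      left_inv := fun _ => rfl
      right_inv := fun _ => rfl
      map_add' := fun _ _ => rfl
      map_smul' := fun _ _ => rfl }

/-- For `k ≤ m` the torsion is generated by the class of `P ^ (m - k)`, whose annihilator is `(P ^
k)`; for `k ≥ m` it is everything. -/
theorem finrank_torsionBy_quotient_pow {P : K[X]} (hP : P.Monic) (h1 : P.natDegree = 1)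
    (k m : ℕ) :
    Module.finrank K (torsionBy K[X] (K[X] ⧸ Ideal.span {P ^ m}) (P ^ k)) = min k m := by
  rcases le_total m k with h | h
  · have : torsionBy K[X] (K[X] ⧸ Ideal.span {P ^ m}) (P ^ k) = ⊤ := by
      rw [eq_top_iff]
      rintro x -
      obtain ⟨f, rfl⟩ := Submodule.Quotient.mk_surjective _ x
      rw [mem_torsionBy_iff, ← Submodule.Quotient.mk_smul, Submodule.Quotient.mk_eq_zero,
        Ideal.mem_span_singleton, smul_eq_mul]
      exact (pow_dvd_pow P h).mul_right f
    rw [this, min_eq_right h]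
    refine (LinearEquiv.finrank_eq (Submodule.topEquiv.restrictScalars K)).trans ?_
    rw [finrank_quotient_span_eq_natDegree, hP.natDegree_pow, h1, mul_one]
  · obtain ⟨j, rfl⟩ := Nat.exists_eq_add_of_le h
    rw [min_eq_left h, pow_add]
    have ht : torsionBy K[X] (K[X] ⧸ Ideal.span {P ^ k * P ^ j}) (P ^ k) =
        Submodule.span K[X] {Submodule.Quotient.mk (P ^ j)} :=
      Ideal.Quotient.torsionBy_eq_span_singleton (P ^ k) (P ^ j)
        (mem_nonZeroDivisors_of_ne_zero (hP.pow k).ne_zero)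
    have ho : Ideal.torsionOf K[X] (K[X] ⧸ Ideal.span {P ^ k * P ^ j})
        (Submodule.Quotient.mk (P ^ j)) = Ideal.span {P ^ k} := by
      ext f
      rw [Ideal.mem_torsionOf_iff, ← Submodule.Quotient.mk_smul, Submodule.Quotient.mk_eq_zero,
        Ideal.mem_span_singleton, Ideal.mem_span_singleton, smul_eq_mul]
      exact mul_dvd_mul_iff_right (hP.pow j).ne_zero
    rw [ht, ← LinearEquiv.finrank_eq ((Ideal.quotTorsionOfEquivSpanSingleton K[X] _
      (Submodule.Quotient.mk (P ^ j))).restrictScalars K), ho, finrank_quotient_span_eq_natDegree,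
      hP.natDegree_pow, h1, mul_one]

omit [Module K M] [IsScalarTower K K[X] M] in
/-- For coprime `f` and `g`, the `f * g`-torsion is the product of the `f`-torsion and of the
`g`-torsion. -/
theorem nonempty_torsionBy_prod_equiv {f g : K[X]} (h : IsCoprime f g) :
    Nonempty ((torsionBy K[X] M f × torsionBy K[X] M g) ≃ₗ[K[X]] torsionBy K[X] M (f * g)) := by
  obtain ⟨s, t, hst⟩ := h
  refine ⟨LinearEquiv.ofBijective (LinearMap.coprod
    (Submodule.inclusion (torsionBy_le_torsionBy_of_dvd f (f * g) ⟨g, rfl⟩))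
    (Submodule.inclusion (torsionBy_le_torsionBy_of_dvd g (f * g) ⟨f, mul_comm f g⟩)))
    ⟨?_, fun y => ?_⟩⟩
  · rw [← LinearMap.ker_eq_bot, LinearMap.ker_eq_bot']
    rintro ⟨⟨x, hx⟩, ⟨y, hy⟩⟩ hxy
    have h0 : x + y = 0 := congrArg Subtype.val hxy
    rw [mem_torsionBy_iff] at hx hy
    have hx0 : x = 0 := by
      have : f • y = 0 := by
        rw [eq_neg_of_add_eq_zero_right h0, smul_neg, hx, neg_zero]
      calc x = (s * f + t * g) • x := by rw [hst, one_smul]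
        _ = s • (f • x) - t • (g • y) := by
          rw [eq_neg_of_add_eq_zero_right h0]
          simp only [add_smul, mul_smul, smul_neg, sub_neg_eq_add]
        _ = 0 := by rw [hx, hy, smul_zero, smul_zero, sub_zero]
    subst hx0
    rw [zero_add] at h0
    subst h0
    rfl
  · obtain ⟨y, hy⟩ := y
    rw [mem_torsionBy_iff] at hy
    refine ⟨(⟨(t * g) • y, ?_⟩, ⟨(s * f) • y, ?_⟩), Subtype.ext ?_⟩
    · rw [mem_torsionBy_iff, smul_smul, mul_left_comm, mul_smul, hy, smul_zero]
    · rw [mem_torsionBy_iff, smul_smul, mul_left_comm, mul_comm g, mul_smul, hy, smul_zero]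
    · change (t * g) • y + (s * f) • y = y
      rw [← add_smul, add_comm, hst, one_smul]

variable (K M) in
/-- The analogue of `nker` for a `K[X]`-module. -/
noncomputable def torsionCount (c : K) (k : ℕ) : ℤ :=
  (Module.finrank K (torsionBy K[X] M ((X - C c) ^ k)) : ℤ) -
    (Module.finrank K (torsionBy K[X] M ((X - C c) ^ (k - 1))) : ℤ)

theorem IsCyclicDecomp.torsionCount_eq [FiniteDimensional K M] {ι : Type*} [Fintype ι]
    {x : ι → M} {c : K} {e : ι → ℕ} (h : IsCyclicDecomp x fun i => (X - C c) ^ e i) {k : ℕ}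
    (hk : 1 ≤ k) : torsionCount K M c k = (Finset.univ.filter fun i => k ≤ e i).card := by
  obtain ⟨E⟩ := h.nonempty_equiv
  have hfin : ∀ i, FiniteDimensional K (K[X] ⧸ Ideal.span {(X - C c) ^ e i}) :=
    fun i => ((monic_X_sub_C c).pow _).finite_quotient
  have key : ∀ k, Module.finrank K (torsionBy K[X] M ((X - C c) ^ k)) = ∑ i, min k (e i) :=
    fun k => by
      rw [finrank_torsionBy_congr E, finrank_torsionBy_pi]
      exact Finset.sum_congr rfl fun i _ =>
        finrank_torsionBy_quotient_pow (monic_X_sub_C c) (natDegree_X_sub_C c) k (e i)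
  -- For `k ≥ 1`, `min k e - min (k - 1) e` is 1 if `k ≤ e` and 0 otherwise; the truncated `k - 1`
  -- would break this at `k = 0`.
  rw [torsionCount, key, key, Finset.card_filter, Nat.cast_sum, Nat.cast_sum, Nat.cast_sum,
    ← Finset.sum_sub_distrib]
  refine Finset.sum_congr rfl fun i _ => ?_
  split_ifs <;> omega

/-- Padding with `m` zero blocks lets two modules be decomposed over the same index set; sorting
makes the `i`-th largest blocks correspond. -/
theorem exists_isCyclicDecomp_pow [FiniteDimensional K M] {c : K} {n : ℕ}
    (h : ∀ x : M, (X - C c) ^ n • x = 0) :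
    ∃ d : ℕ, ∀ m : ℕ, ∃ (x : Fin (d + m) → M) (e : Fin (d + m) → ℕ), Antitone e ∧
      IsCyclicDecomp x fun i => (X - C c) ^ e i := by
  have : Module.Finite K[X] M := Module.Finite.of_restrictScalars_finite K K[X] M
  obtain ⟨d, e, ⟨E⟩⟩ := Module.torsion_by_prime_power_decomposition (M := M)
    (irreducible_X_sub_C c) fun {x} => ⟨⟨_, n, rfl⟩, h x⟩
  obtain ⟨x, hx⟩ := exists_isCyclicDecomp_of_equiv (K := K) (M := M)
    (fun i => (monic_X_sub_C c).pow (e i)) (E.trans (DirectSum.linearEquivFunOnFintype K[X] _ _))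
  refine ⟨d, fun m => ?_⟩
  let e' : Fin (d + m) → ℕ := Fin.append e fun _ => 0
  let x' : Fin (d + m) → M := Fin.append x fun _ => 0
  have hx' : IsCyclicDecomp x' fun i => (X - C c) ^ e' i := by
    refine ⟨fun i => (monic_X_sub_C c).pow _, fun i => ?_, ?_, ?_⟩
    · refine Fin.addCases (fun i => ?_) (fun i => ?_) i
      · simpa [x', e'] using hx.smul_eq_zero i
      · simp [x', e']
    · rw [eq_top_iff, ← hx.span_eq_top]
      refine Submodule.span_mono ?_
      rintro _ ⟨i, rfl⟩
      exact ⟨Fin.castAdd m i, by simp [x']⟩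
    · rw [← hx.sum_natDegree, Fin.sum_univ_add]
      simp [e']
  let σ := Tuple.sort (OrderDual.toDual ∘ e')
  have hσ : Antitone (e' ∘ σ) := fun i j hij => Tuple.monotone_sort (OrderDual.toDual ∘ e') hij
  refine ⟨x' ∘ σ, e' ∘ σ, hσ, fun i => hx'.monic _, fun i => hx'.smul_eq_zero _, ?_, ?_⟩
  · rw [σ.surjective.range_comp, hx'.span_eq_top]
  · rw [← hx'.sum_natDegree]
    exact Equiv.sum_comp σ fun i => ((X - C c) ^ e' i).natDegree

/-- If `k i ≥ l i + 2`, take `m = l i + 1`: all indices up to `i` satisfy `m + 1 ≤ k j`, while only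
indices below `i` can satisfy `m ≤ l j`, against the count. -/
theorem le_add_one_of_card_le {D : ℕ} {k l : Fin D → ℕ} (hk : Antitone k) (hl : Antitone l)
    (h : ∀ m, 1 ≤ m → (Finset.univ.filter fun i => m + 1 ≤ k i).card ≤
      (Finset.univ.filter fun i => m ≤ l i).card) (i : Fin D) : k i ≤ l i + 1 := by
  by_contra hi
  have h1 : Finset.Iic i ⊆ Finset.univ.filter fun j => l i + 1 + 1 ≤ k j := fun j hj => by
    have := hk (Finset.mem_Iic.1 hj)
    simp only [Finset.mem_filter, Finset.mem_univ, true_and]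
    omega
  have h2 : (Finset.univ.filter fun j => l i + 1 ≤ l j) ⊆ Finset.Iio i := fun j hj => by
    rw [Finset.mem_Iio]
    by_contra hji
    have := hl (not_lt.1 hji)
    simp only [Finset.mem_filter, Finset.mem_univ, true_and] at hj
    omega
  have h3 := (Finset.card_le_card h1).trans ((h (l i + 1) (by omega)).trans
    (Finset.card_le_card h2))
  rw [Fin.card_Iic, Fin.card_Iio] at h3
  omega

omit [IsScalarTower K K[X] M] [IsScalarTower K K[X] N] in
-- By the Chinese remainder theorem, a Bézout multiple of `(x i, y i)` isolates each component.
theorem IsCyclicDecomp.prod [FiniteDimensional K M] [FiniteDimensional K N] {ι : Type*}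
    [Fintype ι] {x : ι → M} {y : ι → N} {P Q : ι → K[X]} (hx : IsCyclicDecomp x P)
    (hy : IsCyclicDecomp y Q) (hPQ : ∀ i, IsCoprime (P i) (Q i)) :
    IsCyclicDecomp (fun i => (x i, y i)) fun i => P i * Q i := by
  refine ⟨fun i => (hx.monic i).mul (hy.monic i), fun i => ?_, ?_, ?_⟩
  · refine Prod.ext ?_ ?_
    · rw [Prod.smul_fst, mul_comm, mul_smul, hx.smul_eq_zero, smul_zero, Prod.fst_zero]
    · rw [Prod.smul_snd, mul_smul, hy.smul_eq_zero, smul_zero, Prod.snd_zero]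
  · set S := Submodule.span K[X] (Set.range fun i => (x i, y i)) with hS
    have hmem : ∀ i, (x i, (0 : N)) ∈ S ∧ ((0 : M), y i) ∈ S := fun i => by
      obtain ⟨s, t, hst⟩ := hPQ i
      have h0 : (x i, y i) ∈ S := Submodule.subset_span ⟨i, rfl⟩
      have h1 : (x i, (0 : N)) = (t * Q i) • (x i, y i) := by
        refine Prod.ext ?_ ?_
        · calc x i = (s * P i + t * Q i) • x i := by rw [hst, one_smul]
            _ = (t * Q i) • x i := by
              rw [add_smul, mul_smul s, hx.smul_eq_zero, smul_zero, zero_add]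
        · rw [Prod.smul_snd, mul_smul, hy.smul_eq_zero, smul_zero]
      have h2 : (x i, (0 : N)) ∈ S := h1 ▸ Submodule.smul_mem _ _ h0
      refine ⟨h2, ?_⟩
      have h3 : ((0 : M), y i) = (x i, y i) - (x i, 0) := by simp
      rw [h3]
      exact Submodule.sub_mem _ h0 h2
    have hM : Submodule.map (LinearMap.inl K[X] M N) ⊤ ≤ S := by
      rw [← hx.span_eq_top, Submodule.map_span, Submodule.span_le]
      rintro _ ⟨_, ⟨i, rfl⟩, rfl⟩
      exact (hmem i).1
    have hN : Submodule.map (LinearMap.inr K[X] M N) ⊤ ≤ S := by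
      rw [← hy.span_eq_top, Submodule.map_span, Submodule.span_le]
      rintro _ ⟨_, ⟨i, rfl⟩, rfl⟩
      exact (hmem i).2
    rw [eq_top_iff]
    rintro ⟨m, n⟩ -
    have : (m, n) = LinearMap.inl K[X] M N m + LinearMap.inr K[X] M N n := by simp
    rw [this]
    exact Submodule.add_mem _ (hM ⟨m, trivial, rfl⟩) (hN ⟨n, trivial, rfl⟩)
  · rw [Module.finrank_prod, ← hx.sum_natDegree, ← hy.sum_natDegree, ← Finset.sum_add_distrib]
    exact Finset.sum_congr rfl fun i _ => (hx.monic i).natDegree_mul (hy.monic i)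

/-- Intertwining means that the `i`-th largest blocks of `M` and `N` differ in size by at most one.
As `c ≠ d`, each such pair forms a single cyclic module, to which `hblock` applies. -/
theorem isCompositeModule_prod_of_intertwined [FiniteDimensional K M] [FiniteDimensional K N]
    {α β c d : K} (hcd : c ≠ d)
    (hblock : ∀ k l, k ≤ l + 1 → l ≤ k + 1 →
      IsCompositeModule α β (K[X] ⧸ Ideal.span {(X - C c) ^ k * (X - C d) ^ l}))
    {n : ℕ} (hM : ∀ x : M, (X - C c) ^ n • x = 0) (hN : ∀ x : N, (X - C d) ^ n • x = 0)
    (h : Intertwined (torsionCount K M c) (torsionCount K N d)) :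
    IsCompositeModule α β (M × N) := by
  obtain ⟨m₁, h₁⟩ := exists_isCyclicDecomp_pow hM
  obtain ⟨m₂, h₂⟩ := exists_isCyclicDecomp_pow hN
  obtain ⟨x, k, hk, hx⟩ := h₁ m₂
  obtain ⟨y, l, hl, hy⟩ : ∃ (y : Fin (m₁ + m₂) → N) (l : Fin (m₁ + m₂) → ℕ), Antitone l ∧
      IsCyclicDecomp y fun i => (X - C d) ^ l i := by
    rw [add_comm m₁ m₂]
    exact h₂ m₁
  have hkl : ∀ i, k i ≤ l i + 1 := le_add_one_of_card_le hk hl fun m hm => by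
    have := (h m hm).1
    rw [hx.torsionCount_eq (by omega), hy.torsionCount_eq hm] at this
    exact_mod_cast this
  have hlk : ∀ i, l i ≤ k i + 1 := le_add_one_of_card_le hl hk fun m hm => by
    have := (h m hm).2
    rw [hx.torsionCount_eq hm, hy.torsionCount_eq (by omega)] at this
    exact_mod_cast this
  have hco : ∀ i, IsCoprime ((X - C c) ^ k i) ((X - C d) ^ l i) := fun i =>
    (isCoprime_X_sub_C_of_isUnit_sub (sub_ne_zero.2 hcd).isUnit).pow
  obtain ⟨E⟩ := (hx.prod hy hco).nonempty_equiv
  exact (IsCompositeModule.pi fun i => hblock _ _ (hkl i) (hlk i)).of_equiv E.symm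

/-- As `c + d = α + β`, powers of `(X - c)(X - d)` are fixed by the reflection; unequal exponents
leave one extra linear factor. -/
theorem isCompositeModule_quotient_pow {α β c d : K} (hα : α ≠ 0) (hβ : β ≠ 0)
    (hd : α + β ≠ 0) (hcd : c + d = α + β) (hc : c ∈ ({0, α, β, α + β} : Set K))
    (hd' : d ∈ ({0, α, β, α + β} : Set K)) {k l : ℕ} (hkl : k ≤ l + 1) (hlk : l ≤ k + 1) :
    IsCompositeModule α β (K[X] ⧸ Ideal.span {(X - C c) ^ k * (X - C d) ^ l}) := by
  have hR : ∀ k, reflection (α + β) (((X - C c) * (X - C d)) ^ k) =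
      ((X - C c) * (X - C d)) ^ k := fun k => by
    rw [map_pow, map_mul, map_sub, map_sub, reflection_X, reflection_C, reflection_C, ← hcd, C_add]
    congr 1
    ring
  rcases lt_trichotomy k l with h | rfl | h
  · obtain rfl : l = k + 1 := by omega
    have := (isCompositeModule_quotient_of_reflection hα hβ hd (hR k)).2 d hd'
    rwa [mul_pow, mul_assoc, ← pow_succ] at this
  · have := (isCompositeModule_quotient_of_reflection hα hβ hd (hR k)).1
    rwa [mul_pow] at this
  · obtain rfl : k = l + 1 := by omega
    have := (isCompositeModule_quotient_of_reflection hα hβ hd (hR l)).2 c hc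
    rwa [mul_pow, mul_right_comm, ← pow_succ] at this

end Torsion

/-! ### Separating the roots in a given set -/

section PartOff

variable {K : Type*} [Field K]

theorem roots_partOff (S : Set K) [DecidablePred (· ∈ S)] {f : K[X]} (hf : f ≠ 0) :
    (partOff S f).roots = f.roots.filter (· ∉ S) := by
  have h := partIn_mul_partOff S f
  have h1 := congrArg roots h
  rw [roots_mul (by rwa [h])] at h1
  have h2 : (partIn S f).roots = f.roots.filter (· ∈ S) := by
    rw [partIn, roots_multiset_prod_X_sub_C]
    congr!
  rw [h2] at h1
  exact add_left_cancel (h1.trans (Multiset.filter_add_not _ _).symm)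

theorem partOff_eval_ne_zero {S : Set K} {f : K[X]} (hf : f ≠ 0) {c : K} (hc : c ∈ S) :
    (partOff S f).eval c ≠ 0 := by
  classical
  intro h
  have h0 : partOff S f ≠ 0 := by
    intro h0
    apply hf
    rw [← partIn_mul_partOff S f, h0, mul_zero]
  have : c ∈ (partOff S f).roots := (mem_roots h0).2 h
  rw [roots_partOff S hf, Multiset.mem_filter] at this
  exact this.2 hc

theorem exists_partIn_dvd_pow (S : Set K) (f : K[X]) {s : K[X]}
    (hs : ∀ c ∈ S, X - C c ∣ s) : ∃ n, partIn S f ∣ s ^ n := by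
  classical
  rw [partIn]
  have key : ∀ m : Multiset K, (∀ c ∈ m, c ∈ S) →
      (m.map fun l => X - C l).prod ∣ s ^ Multiset.card m := by
    intro m
    induction m using Multiset.induction with
    | empty => simp
    | cons c m ih =>
      intro hm
      rw [Multiset.map_cons, Multiset.prod_cons, Multiset.card_cons, pow_succ']
      exact mul_dvd_mul (hs c (hm c (Multiset.mem_cons_self c m)))
        (ih fun d hd => hm d (Multiset.mem_cons_of_mem hd))
  exact ⟨_, key _ fun c hc => (Multiset.mem_filter.1 hc).2⟩

theorem isCoprime_X_sub_C_of_eval_ne_zero {f : K[X]} {c : K} (h : f.eval c ≠ 0) :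
    IsCoprime (X - C c) f := by
  rw [(irreducible_X_sub_C c).coprime_iff_not_dvd, dvd_iff_isRoot]
  exact h

end PartOff

/-! ### Sufficiency: assembling the primary components -/

section Sufficiency

variable {K E : Type*} [Field K] [AddCommGroup E] [Module K E]

open Submodule Module

theorem torsionCount_aeval (u : End K E) (c : K) :
    torsionCount K (AEval' u) c = nker u c := by
  have key : ∀ k, finrank K (torsionBy K[X] (AEval' u) ((X - C c) ^ k)) =
      finrank K (LinearMap.ker ((u - algebraMap K (End K E) c) ^ k)) := fun k => by
    have h : (u - algebraMap K (End K E) c) ^ k = aeval u ((X - C c) ^ k) := by simp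
    rw [h]
    exact LinearEquiv.finrank_eq
      { toFun := fun x => ⟨(AEval'.of u).symm x.1, x.2⟩
        invFun := fun x => ⟨AEval'.of u x.1, x.2⟩
        left_inv := fun _ => rfl
        right_inv := fun _ => rfl
        map_add' := fun _ _ => rfl
        map_smul' := fun _ _ => rfl }
  ext k
  rw [torsionCount, nker, key, key]

/-- Every kernel of a power of `X - c` lies in the `(X - c) ^ n`-torsion, because `g` is coprime to
that power. -/
theorem torsionCount_torsionBy {M : Type*} [AddCommGroup M] [Module K M] [Module K[X] M]
    [IsScalarTower K K[X] M] {c : K} {n : ℕ} {g : K[X]} (hg : g.eval c ≠ 0)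
    (h : ∀ x : M, ((X - C c) ^ n * g) • x = 0) :
    torsionCount K (torsionBy K[X] M ((X - C c) ^ n)) c = torsionCount K M c := by
  have key : ∀ k, torsionBy K[X] M ((X - C c) ^ k) ≤ torsionBy K[X] M ((X - C c) ^ n) := by
    intro k x hx
    rw [mem_torsionBy_iff] at hx ⊢
    obtain ⟨s, t, hst⟩ := (isCoprime_X_sub_C_of_eval_ne_zero hg).pow_left (m := k)
    calc (X - C c) ^ n • x = (s * (X - C c) ^ k + t * g) • (X - C c) ^ n • x := by
          rw [hst, one_smul]
      _ = (s * (X - C c) ^ n) • (X - C c) ^ k • x + t • ((X - C c) ^ n * g) • x := by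
          simp only [smul_smul, ← add_smul]
          congr 1
          ring
      _ = 0 := by rw [hx, h, smul_zero, smul_zero, add_zero]
  ext k
  rw [torsionCount, torsionCount, finrank_torsionBy_submodule (key _),
    finrank_torsionBy_submodule (key _)]

theorem isCompositeModule_torsionBy_of_restrictOff {α β : K} {u : End K E} {S : Set K}
    (h : IsComposite α β (restrictOff u S)) :
    IsCompositeModule α β (torsionBy K[X] (AEval' u) (partOff S (minpoly K u))) := by
  let e : kerOff u S ≃ₗ[K] torsionBy K[X] (AEval' u) (partOff S (minpoly K u)) :=
    { toFun := fun x => ⟨AEval'.of u x.1, x.2⟩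
      invFun := fun x => ⟨(AEval'.of u).symm x.1, x.2⟩
      left_inv := fun _ => rfl
      right_inv := fun _ => rfl
      map_add' := fun _ _ => rfl
      map_smul' := fun _ _ => rfl }
  exact IsComposite.of_equiv e
    (fun x => Subtype.ext (AEval'.X_smul_of u x.1).symm) h

theorem isComposite_of_elementaryFactors {α β : K} (hα : α ≠ 0) (hβ : β ≠ 0) (hd : α + β ≠ 0)
    {v : End K E} {N : ℕ} {P : Fin N → K[X]} (h : IsElementaryFactors v P)
    (hP : ∀ i, IsPolynomialOf ((X - C α) * (X - C β)) (P i)) : IsComposite α β v := by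
  obtain ⟨e⟩ := h.equiv
  refine isCompositeModule_aeval_iff.1 ((IsCompositeModule.pi fun i => ?_).of_equiv e.symm)
  obtain ⟨R, hR⟩ := hP i
  rw [hR]
  refine (isCompositeModule_quotient_of_reflection hα hβ hd (reflection_comp_of_eq ?_ R)).1
  rw [map_mul, map_sub, map_sub, reflection_X, reflection_C, reflection_C, C_add]
  ring

theorem isComposite_of_conditions [FiniteDimensional K E] {α β : K} (hα : α ≠ 0) (hβ : β ≠ 0)
    (hne : α ≠ β) (hd : α + β ≠ 0) {u : End K E}
    (h₀ : Intertwined (nker u 0) (nker u (α + β))) (h₁ : Intertwined (nker u α) (nker u β))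
    (h₂ : IsComposite α β (restrictOff u {0, α, β, α + β})) : IsComposite α β u := by
  set S : Set K := {0, α, β, α + β} with hS
  set Q := partOff S (minpoly K u) with hQ
  have hm0 : minpoly K u ≠ 0 := minpoly.ne_zero (Algebra.IsIntegral.isIntegral u)
  have hS0 : (0 : K) ∈ S := by simp [hS]
  have hSα : α ∈ S := by simp [hS]
  have hSβ : β ∈ S := by simp [hS]
  have hSd : α + β ∈ S := by simp [hS]
  have hQS : ∀ c ∈ S, Q.eval c ≠ 0 := fun c hc => partOff_eval_ne_zero hm0 hc
  obtain ⟨n, hn⟩ := exists_partIn_dvd_pow S (minpoly K u)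
    (s := (X - C 0) * (X - C (α + β)) * ((X - C α) * (X - C β))) (by
      rintro c (rfl | rfl | rfl | rfl)
      · exact ⟨(X - C (α + β)) * ((X - C α) * (X - C β)), by ring⟩
      · exact ⟨(X - C 0) * (X - C (c + β)) * (X - C β), by ring⟩
      · exact ⟨(X - C 0) * (X - C (α + c)) * (X - C α), by ring⟩
      · exact ⟨(X - C 0) * ((X - C α) * (X - C β)), by ring⟩)
  let L : K → K[X] := fun c => (X - C c) ^ n
  -- A multiple of the minimal polynomial with one common exponent `n`; its bracketing dictates the
  -- splitting into two pairs of eigenspaces and the remainder.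
  let T := L 0 * L (α + β) * (L α * L β * Q)
  have hT : ∀ x : AEval' u, T • x = 0 := by
    have h1 : minpoly K u ∣ T := by
      rw [← partIn_mul_partOff S (minpoly K u)]
      refine (mul_dvd_mul_right hn _).trans (dvd_of_eq ?_)
      simp only [T, L, mul_pow, mul_assoc, hQ]
    intro x
    have h2 : aeval u T = 0 := (minpoly.dvd_iff).1 h1
    obtain ⟨y, rfl⟩ := (AEval'.of u).surjective x
    change AEval'.of u (aeval u T y) = 0
    rw [h2, LinearMap.zero_apply, map_zero]
  have hLco : ∀ {c d : K}, c ≠ d → IsCoprime (L c) (L d) := fun h =>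
    (isCoprime_X_sub_C_of_isUnit_sub (sub_ne_zero.2 h).isUnit).pow
  have hLQ : ∀ c ∈ S, IsCoprime (L c) Q := fun c hc =>
    (isCoprime_X_sub_C_of_eval_ne_zero (hQS c hc)).pow_left
  have hL : ∀ {c d : K}, c ≠ d → (L d).eval c ≠ 0 := fun h => by
    simp only [L, eval_pow, eval_sub, eval_X, eval_C]
    exact pow_ne_zero _ (sub_ne_zero.2 h)
  have h0d : (0 : K) ≠ α + β := hd.symm
  have hαd : α ≠ α + β := by simpa using hβ
  have hβd : β ≠ α + β := by simpa using hα
  have count : ∀ (c : K) (g : K[X]), g.eval c ≠ 0 → T = L c * g →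
      torsionCount K (torsionBy K[X] (AEval' u) (L c)) c = nker u c := fun c g hg hcg => by
    rw [← torsionCount_aeval]
    exact torsionCount_torsionBy hg fun x => hcg ▸ hT x
  have fin : ∀ f, FiniteDimensional K (torsionBy K[X] (AEval' u) f) := fun f =>
    Module.Finite.of_injective ((torsionBy K[X] (AEval' u) f).subtype.restrictScalars K)
      Subtype.val_injective
  have g₀ : IsCompositeModule α β
      (torsionBy K[X] (AEval' u) (L 0) × torsionBy K[X] (AEval' u) (L (α + β))) := by
    refine isCompositeModule_prod_of_intertwined h0d (fun k l => isCompositeModule_quotient_pow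
      hα hβ hd (zero_add _) hS0 hSd) (smul_torsionBy _) (smul_torsionBy _) ?_
    rw [count 0 (L (α + β) * (L α * L β * Q)) _ (by ring),
      count (α + β) (L 0 * (L α * L β * Q)) _ (by ring)]
    · exact h₀
    · simp only [eval_mul]
      exact mul_ne_zero (hL h0d.symm) (mul_ne_zero (mul_ne_zero (hL hαd.symm) (hL hβd.symm))
        (hQS _ hSd))
    · simp only [eval_mul]
      exact mul_ne_zero (hL h0d) (mul_ne_zero (mul_ne_zero (hL hα.symm) (hL hβ.symm))
        (hQS _ hS0))
  have g₁ : IsCompositeModule α β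
      (torsionBy K[X] (AEval' u) (L α) × torsionBy K[X] (AEval' u) (L β)) := by
    refine isCompositeModule_prod_of_intertwined hne (fun k l => isCompositeModule_quotient_pow
      hα hβ hd rfl hSα hSβ) (smul_torsionBy _) (smul_torsionBy _) ?_
    rw [count α (L 0 * L (α + β) * (L β * Q)) _ (by ring),
      count β (L 0 * L (α + β) * (L α * Q)) _ (by ring)]
    · exact h₁
    · simp only [eval_mul]
      exact mul_ne_zero (mul_ne_zero (hL hβ) (hL hβd)) (mul_ne_zero (hL hne.symm) (hQS _ hSβ))
    · simp only [eval_mul]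
      exact mul_ne_zero (mul_ne_zero (hL hα) (hL hαd)) (mul_ne_zero (hL hne) (hQS _ hSα))
  obtain ⟨e₀⟩ := nonempty_torsionBy_prod_equiv (M := AEval' u) (hLco h0d)
  obtain ⟨e₁⟩ := nonempty_torsionBy_prod_equiv (M := AEval' u) (hLco hne)
  obtain ⟨e₂⟩ := nonempty_torsionBy_prod_equiv (M := AEval' u)
    (IsCoprime.mul_left (hLQ α hSα) (hLQ β hSβ))
  obtain ⟨e₃⟩ := nonempty_torsionBy_prod_equiv (M := AEval' u)
    (IsCoprime.mul_left
      (IsCoprime.mul_right (IsCoprime.mul_right (hLco hα.symm) (hLco hβ.symm)) (hLQ 0 hS0))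
      (IsCoprime.mul_right (IsCoprime.mul_right (hLco hαd.symm) (hLco hβd.symm)) (hLQ _ hSd)))
  have g₂ := (((g₀.of_equiv e₀).prod (((g₁.of_equiv e₁).prod
    (isCompositeModule_torsionBy_of_restrictOff h₂)).of_equiv e₂)).of_equiv e₃)
  have htop : torsionBy K[X] (AEval' u) T = ⊤ := eq_top_iff.2 fun x _ => hT x
  exact isCompositeModule_aeval_iff.1 (g₂.of_equiv
    ((LinearEquiv.ofEq _ _ htop).trans Submodule.topEquiv))

end Sufficiency

/-! ### Commutator identities -/

section Identities

variable {K A : Type*} [Field K] [Ring A] [Algebra K A] {α β : K} {a b : A}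

/-- With `z = ab - ba`, the quadratic equations give `az + za = αz` and `bz + zb = βz`; the identity
is their sum. -/
theorem commutator_mul_add (ha : a * a = α • a) (hb : b * b = β • b) :
    (a * b - b * a) * (a + b) = -((a + b - algebraMap K A (α + β)) * (a * b - b * a)) := by
  have ha' : ∀ x, a * (a * x) = α • (a * x) := fun x => by
    rw [← mul_assoc, ha, smul_mul_assoc]
  have hb' : ∀ x, b * (b * x) = β • (b * x) := fun x => by
    rw [← mul_assoc, hb, smul_mul_assoc]
  simp only [Algebra.algebraMap_eq_smul_one, mul_add, add_mul, sub_mul, mul_sub, smul_mul_assoc,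
    mul_smul_comm, mul_assoc, one_mul, ha, hb, ha', hb']
  module

theorem commutator_mul_sub (ha : a * a = α • a) (hb : b * b = β • b) :
    (a * b - b * a) * (a + b - algebraMap K A (α + β)) = -((a + b) * (a * b - b * a)) := by
  rw [mul_sub, commutator_mul_add ha hb, Algebra.algebraMap_eq_smul_one, mul_smul_comm, mul_one,
    sub_mul, smul_mul_assoc, one_mul]
  abel

/-- The product is `ab + ba - βa - αb`, and multiplying it by `a` on either side gives `aba - αβa`.
-/
theorem commute_left_mul (ha : a * a = α • a) (hb : b * b = β • b) :
    Commute a ((a + b) * (a + b - algebraMap K A (α + β))) := by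
  have ha' : ∀ x, a * (a * x) = α • (a * x) := fun x => by
    rw [← mul_assoc, ha, smul_mul_assoc]
  rw [commute_iff_eq]
  simp only [Algebra.algebraMap_eq_smul_one, mul_add, add_mul, sub_mul, mul_sub, smul_mul_assoc,
    mul_smul_comm, mul_assoc, mul_one, ha, hb, ha', smul_add]
  module

theorem mul_mul_self_eq (ha : a * a = α • a) (hb : b * b = β • b) :
    a * b * a =
      ((a + b) * (a + b - algebraMap K A (α + β)) + algebraMap K A (α * β)) * a := by
  simp only [Algebra.algebraMap_eq_smul_one, mul_add, add_mul, sub_mul, mul_sub, smul_mul_assoc,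
    mul_smul_comm, mul_assoc, one_mul, mul_one, ha, hb, smul_add]
  module

theorem commutator_mul_commutator (ha : a * a = α • a) (hb : b * b = β • b) :
    (a * b - b * a) * (a * b - b * a) =
      (a + b) * (a + b - algebraMap K A (α + β)) *
        ((a + b) * (a + b - algebraMap K A (α + β)) + algebraMap K A (α * β)) := by
  have ha' : ∀ x, a * (a * x) = α • (a * x) := fun x => by
    rw [← mul_assoc, ha, smul_mul_assoc]
  have hb' : ∀ x, b * (b * x) = β • (b * x) := fun x => by
    rw [← mul_assoc, hb, smul_mul_assoc]
  have h : (a + b) * (a + b - algebraMap K A (α + β)) = a * b + b * a - β • a - α • b := by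
    simp only [Algebra.algebraMap_eq_smul_one, mul_add, add_mul, mul_sub,
      mul_smul_comm, mul_one, ha, hb, smul_add]
    module
  rw [h]
  simp only [Algebra.algebraMap_eq_smul_one, mul_add, add_mul, sub_mul, mul_sub, smul_mul_assoc,
    mul_smul_comm, mul_assoc, mul_one, ha, hb, ha', hb', smul_add, smul_sub]
  module

theorem mul_commutator (ha : a * a = α • a) :
    a * (a * b - b * a) = α • (a * b - b * a) - (a * b - b * a) * a := by
  simp only [sub_mul, mul_sub, ← mul_assoc, ha, smul_mul_assoc, smul_sub]
  simp only [mul_assoc, ha, mul_smul_comm]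
  abel

end Identities

/-! ### Necessity of the intertwining conditions -/

section KernelCount

variable {K E : Type*} [Field K] [AddCommGroup E] [Module K E]

open Module LinearMap

/-- `f` induces a map from `S'` to `T' / T` whose kernel lies in `S`. -/
theorem finrank_add_finrank_le_of_map [FiniteDimensional K E] {S S' T T' : Submodule K E}
    (f : End K E) (hT : T ≤ T') (hf : ∀ x ∈ S', f x ∈ T') (h : ∀ x ∈ S', f x ∈ T → x ∈ S) :
    finrank K S' + finrank K T ≤ finrank K T' + finrank K S := by
  let g : S' →ₗ[K] E ⧸ T := (T.mkQ ∘ₗ f).domRestrict S'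
  let t : T' →ₗ[K] E ⧸ T := T.mkQ.domRestrict T'
  have h1 := finrank_range_add_finrank_ker g
  have h2 := finrank_range_add_finrank_ker t
  have h3 : finrank K (ker g) ≤ finrank K S := by
    rw [← Submodule.finrank_map_subtype_eq S' (ker g)]
    refine Submodule.finrank_mono ?_
    rintro _ ⟨x, hx, rfl⟩
    exact h x x.2 ((Submodule.Quotient.mk_eq_zero T).1 hx)
  have h4 : finrank K (range g) ≤ finrank K (range t) := by
    refine Submodule.finrank_mono ?_
    rintro _ ⟨x, rfl⟩
    exact ⟨⟨f x, hf x x.2⟩, rfl⟩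
  have h5 : finrank K T ≤ finrank K (ker t) := by
    rw [← Submodule.finrank_map_subtype_eq T' (ker t)]
    refine Submodule.finrank_mono fun x hx => ?_
    exact ⟨⟨x, hT hx⟩, (Submodule.Quotient.mk_eq_zero T).2 hx, rfl⟩
  omega

/-- `z ^ (2 * k) = d ^ k * u ^ k`, and `d` is injective on `ker (u ^ n)`. -/
theorem ker_pow_inf_ker_pow {u d z : End K E} (hud : Commute u d) (hz : z * z = u * d) {n k : ℕ}
    (hinj : ∀ x, (u ^ n) x = 0 → d x = 0 → x = 0) (hk : k ≤ n) :
    ker (z ^ (2 * k)) ⊓ ker (u ^ n) = ker (u ^ k) := by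
  have hzk : z ^ (2 * k) = d ^ k * u ^ k := by
    rw [pow_mul, pow_two, hz, hud.mul_pow, (hud.pow_pow k k).eq]
  have hd : ∀ m x, (u ^ n) x = 0 → (d ^ m) x = 0 → x = 0 := by
    intro m
    induction m with
    | zero => intro x _ hx; simpa using hx
    | succ m ih =>
      intro x hx hdx
      rw [pow_succ, End.mul_apply] at hdx
      refine hinj x hx (ih _ ?_ hdx)
      rw [← End.mul_apply, (hud.pow_left n).eq, End.mul_apply, hx, map_zero]
  ext x
  simp only [Submodule.mem_inf, mem_ker, hzk, End.mul_apply]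
  constructor
  · rintro ⟨h1, h2⟩
    refine hd k _ ?_ h1
    rw [← End.mul_apply, ← pow_add, add_comm, pow_add, End.mul_apply, h2, map_zero]
  · intro h
    refine ⟨by rw [h, map_zero], ?_⟩
    rw [← Nat.sub_add_cancel hk, pow_add, End.mul_apply, h, map_zero]

/-- `z` acts as a square root of `u` and of `v`, up to injective factors, and exchanges their
generalized kernels. Filtering these by the kernels of `z ^ j` refines the filtrations by `ker (u ^
k)` and `ker (v ^ k)`, and `z` lowers the level by one while switching sides. -/
theorem finrank_ker_pow_le [FiniteDimensional K E] {u v d e z : End K E} (hud : Commute u d)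
    (hve : Commute v e) (hz : z * z = u * d) (hz' : z * z = v * e)
    (hinj : ∀ n x, (u ^ n) x = 0 → d x = 0 → x = 0)
    (hinj' : ∀ n x, (v ^ n) x = 0 → e x = 0 → x = 0) (hzu : z * u = -(v * z))
    (hzv : z * v = -(u * z)) {k : ℕ} (hk : 1 ≤ k) :
    finrank K (ker (u ^ (k + 1))) + finrank K (ker (v ^ (k - 1))) ≤
      finrank K (ker (v ^ k)) + finrank K (ker (u ^ k)) := by
  have maps : ∀ {u v : End K E}, z * u = -(v * z) → ∀ x, (u ^ (k + 1)) x = 0 →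
      (v ^ (k + 1)) (z x) = 0 := by
    intro u v h x hx
    have h1 : SemiconjBy z u (-v) := by rw [SemiconjBy, h, neg_mul]
    have h2 := (h1.pow_right (k + 1)).eq
    rw [neg_pow, mul_assoc] at h2
    have h3 := congr_fun (congrArg DFunLike.coe h2) x
    rw [End.mul_apply, hx, map_zero] at h3
    rcases neg_one_pow_eq_or (End K E) (k + 1) with h4 | h4
    · rw [h4, one_mul] at h3
      exact h3.symm
    · rw [h4, neg_one_mul, LinearMap.neg_apply, zero_eq_neg] at h3
      exact h3
  let U : ℕ → Submodule K E := fun j => ker (z ^ j) ⊓ ker (u ^ (k + 1))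
  let V : ℕ → Submodule K E := fun j => ker (z ^ j) ⊓ ker (v ^ (k + 1))
  have hmono : ∀ j, ker (z ^ j) ≤ ker (z ^ (j + 1)) := fun j x hx => by
    rw [mem_ker] at hx ⊢
    rw [pow_succ', End.mul_apply, hx, map_zero]
  have hUV : ∀ j, finrank K (U (j + 2)) + finrank K (V j) ≤
      finrank K (V (j + 1)) + finrank K (U (j + 1)) := fun j => by
    refine finrank_add_finrank_le_of_map z (inf_le_inf_right _ (hmono j)) ?_ ?_
    · rintro x ⟨h1, h2⟩
      exact ⟨h1, maps hzu x h2⟩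
    · rintro x ⟨h1, h2⟩ ⟨h3, h4⟩
      exact ⟨h3, h2⟩
  have hVU : ∀ j, finrank K (V (j + 2)) + finrank K (U j) ≤
      finrank K (U (j + 1)) + finrank K (V (j + 1)) := fun j => by
    refine finrank_add_finrank_le_of_map z (inf_le_inf_right _ (hmono j)) ?_ ?_
    · rintro x ⟨h1, h2⟩
      exact ⟨h1, maps hzv x h2⟩
    · rintro x ⟨h1, h2⟩ ⟨h3, h4⟩
      exact ⟨h3, h2⟩
  have hU : ∀ m ≤ k + 1, U (2 * m) = ker (u ^ m) := fun m hm =>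
    ker_pow_inf_ker_pow hud hz (hinj _) hm
  have hV : ∀ m ≤ k + 1, V (2 * m) = ker (v ^ m) := fun m hm =>
    ker_pow_inf_ker_pow hve hz' (hinj' _) hm
  obtain ⟨m, rfl⟩ : ∃ m, k = m + 1 := ⟨k - 1, by omega⟩
  rw [← hU (m + 1 + 1) le_rfl, ← hV (m + 1 - 1) (by omega), ← hV (m + 1) (by omega),
    ← hU (m + 1) (by omega), Nat.add_sub_cancel]
  -- With `u_j = dim U j - dim U (j - 1)` and `v_j` likewise, these say `u_{2m+4} ≤ v_{2m+3} ≤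
  -- u_{2m+2} ≤ v_{2m+1}` and `u_{2m+3} ≤ v_{2m+2}`; adding the two outer bounds gives the claim.
  have h1 := hUV (2 * m + 2)
  have h2 : finrank K (V (2 * m + 2 + 1)) + finrank K (U (2 * m + 1)) ≤
      finrank K (U (2 * m + 2)) + finrank K (V (2 * m + 2)) := hVU (2 * m + 1)
  have h3 := hUV (2 * m)
  have h4 : finrank K (U (2 * m + 2 + 1)) + finrank K (V (2 * m + 1)) ≤
      finrank K (V (2 * m + 2)) + finrank K (U (2 * m + 2)) := hUV (2 * m + 1)
  have e1 : 2 * (m + 1 + 1) = 2 * m + 2 + 2 := by ring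
  have e2 : 2 * (m + 1) = 2 * m + 2 := by ring
  rw [e1, e2]
  omega

theorem eq_zero_of_isCoprime_aeval {u : End K E} {f g : K[X]} (h : IsCoprime f g) {x : E}
    (hf : aeval u f x = 0) (hg : aeval u g x = 0) : x = 0 := by
  have := (disjoint_ker_aeval_of_isCoprime u h).le_bot (x := x) ⟨hf, hg⟩
  simpa using this

theorem intertwined_of_isComposite [FiniteDimensional K E] {α β : K} (hα : α ≠ 0) (hβ : β ≠ 0)
    (hd : α + β ≠ 0) {u : End K E} (h : IsComposite α β u) :
    Intertwined (nker u 0) (nker u (α + β)) := by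
  obtain ⟨a, b, ha, hb, rfl⟩ := (isComposite_iff hα hβ).1 h
  set u := a + b with hu
  set v := u - algebraMap K (End K E) (α + β) with hv
  set z := a * b - b * a
  set c := u * v + algebraMap K (End K E) (α * β)
  have hpu : aeval u (X : K[X]) = u := aeval_X u
  have hpv : aeval u (X - C (α + β)) = v := by simp [hv]
  have hpc : aeval u ((X - C α) * (X - C β)) = c := by
    have : ((X - C α) * (X - C β) : K[X]) = X * (X - C (α + β)) + C (α * β) := by
      rw [C_add, C_mul]; ring
    rw [this, map_add, map_mul, hpu, hpv, aeval_C]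
  have hcomm : ∀ f g : K[X], Commute (aeval u f) (aeval u g) := fun f g =>
    (Commute.all f g).map (aeval u)
  have hzz : z * z = u * (v * c) := by
    rw [← mul_assoc]; exact commutator_mul_commutator ha hb
  have hzz' : z * z = v * (u * c) := by
    have := (hcomm X (X - C (α + β))).eq
    rw [hpu, hpv] at this
    rw [hzz, ← mul_assoc, this, mul_assoc]
  have hdu : aeval u ((X - C (α + β)) * ((X - C α) * (X - C β))) = v * c := by
    rw [map_mul, hpv, hpc]
  have hev : aeval u (X * ((X - C α) * (X - C β))) = u * c := by
    rw [map_mul, hpu, hpc]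
  have hud : Commute u (v * c) := by
    rw [← hdu]; nth_rewrite 1 [← hpu]; exact hcomm _ _
  have hve : Commute v (u * c) := by
    rw [← hev, ← hpv]; exact hcomm _ _
  have hinj : ∀ n x, (u ^ n) x = 0 → (v * c) x = 0 → x = 0 := fun n x h1 h2 => by
    refine eq_zero_of_isCoprime_aeval (u := u) (f := (X - C 0) ^ n)
      (g := (X - C (α + β)) * ((X - C α) * (X - C β)))
      (isCoprime_X_sub_C_of_eval_ne_zero ?_).pow_left ?_ ?_
    · simp only [eval_mul, eval_sub, eval_X, eval_C, zero_sub]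
      exact mul_ne_zero (neg_ne_zero.2 hd) (mul_ne_zero (neg_ne_zero.2 hα) (neg_ne_zero.2 hβ))
    · rw [C_0, sub_zero, map_pow, hpu]; exact h1
    · rw [hdu]; exact h2
  have hinj' : ∀ n x, (v ^ n) x = 0 → (u * c) x = 0 → x = 0 := fun n x h1 h2 => by
    refine eq_zero_of_isCoprime_aeval (u := u) (f := (X - C (α + β)) ^ n)
      (g := X * ((X - C α) * (X - C β)))
      (isCoprime_X_sub_C_of_eval_ne_zero ?_).pow_left ?_ ?_
    · simp [hα, hβ, hd]
    · rw [map_pow, hpv]; exact h1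
    · rw [hev]; exact h2
  have hzu : z * u = -(v * z) := commutator_mul_add ha hb
  have hzv : z * v = -(u * z) := commutator_mul_sub ha hb
  intro k hk
  have h1 := finrank_ker_pow_le hud hve hzz hzz' hinj hinj' hzu hzv hk
  have h2 := finrank_ker_pow_le hve hud hzz' hzz hinj' hinj hzv hzu hk
  have h3 : ∀ j, nker u 0 j = finrank K (ker (u ^ j)) - finrank K (ker (u ^ (j - 1))) :=
    fun j => by rw [nker, map_zero, sub_zero]
  have h4 : ∀ j, nker u (α + β) j = finrank K (ker (v ^ j)) - finrank K (ker (v ^ (j - 1))) :=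
    fun j => rfl
  rw [h3, h3, h4, h4, Nat.add_sub_cancel]
  omega

/-- `u - α` is a `(-α, β)`-composite, and its eigenvalues `0` and `β - α` correspond to `α` and `β`
for `u`. -/
theorem intertwined_of_isComposite' [FiniteDimensional K E] {α β : K} (hα : α ≠ 0) (hβ : β ≠ 0)
    (hne : α ≠ β) {u : End K E} (h : IsComposite α β u) :
    Intertwined (nker u α) (nker u β) := by
  have h1 := intertwined_of_isComposite (neg_ne_zero.2 hα) hβ
    (by rwa [neg_add_eq_sub, sub_ne_zero, ne_comm]) h.sub_algebraMap
  have key : ∀ c, nker (u - algebraMap K (End K E) α) c = nker u (α + c) := fun c => by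
    ext k
    rw [nker, nker, map_add, sub_sub]
  rwa [key, key, add_zero, add_neg_cancel_left] at h1

end KernelCount

/-! ### Necessity of the condition on elementary factors -/

section Necessity

variable {K E : Type*} [Field K] [AddCommGroup E] [Module K E]

open Module LinearMap

theorem map_smul_eq_comp_smul {M N : Type*} [AddCommGroup M] [Module K M] [Module K[X] M]
    [IsScalarTower K K[X] M] [AddCommGroup N] [Module K N] [Module K[X] N]
    [IsScalarTower K K[X] N] {Y : K[X]} (j : M →ₗ[K] N) (hj : ∀ m, j ((X : K[X]) • m) = Y • j m)
    (f : K[X]) (m : M) : j (f • m) = f.comp Y • j m := by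
  induction f using Polynomial.induction_on' generalizing m with
  | add f g hf hg => rw [add_smul, map_add, hf, hg, Polynomial.add_comp, add_smul]
  | monomial n c =>
    rw [← C_mul_X_pow_eq_monomial, mul_comp, C_comp, X_pow_comp, mul_smul, mul_smul]
    rw [← algebraMap_eq, algebraMap_smul, algebraMap_smul, map_smul]
    congr 1
    induction n generalizing m with
    | zero => simp
    | succ n ih => rw [pow_succ, mul_smul, ih, hj, pow_succ, mul_smul]

/-- The invariant factors `R i` of `Y(u)` on `range a` give those of `u`: the same generators are
killed by `(R i)(Y)`, whose degrees add up to `2 * dim (range a) = dim E`, so only generation over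
`K[X]` remains. -/
theorem exists_elementaryFactors_of_isComposite [FiniteDimensional K E] {α β : K} (hα : α ≠ 0)
    (hβ : β ≠ 0) {u : End K E} (h : IsComposite α β u)
    (hinj : ∀ x, aeval u (X * (X - C (α + β)) * ((X - C α) * (X - C β))) x = 0 → x = 0) :
    ∃ (N : ℕ) (P : Fin N → K[X]), IsElementaryFactors u P ∧
      ∀ i, IsPolynomialOf ((X - C α) * (X - C β)) (P i) := by
  obtain ⟨a, b, ha, hb, rfl⟩ := (isComposite_iff hα hβ).1 h
  set u := a + b with hu
  set Y : K[X] := (X - C α) * (X - C β) with hY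
  set T : End K E := aeval u Y with hT
  set w := u * (u - algebraMap K (End K E) (α + β)) with hw
  set z := a * b - b * a with hz
  have hTw : T = w + algebraMap K (End K E) (α * β) := by
    have : Y = X * (X - C (α + β)) + C (α * β) := by
      rw [hY, C_add, C_mul]; ring
    rw [hT, this, map_add, map_mul, map_sub, aeval_X, aeval_C, aeval_C]
  have hzz : z * z = w * T := by
    rw [hTw]; exact commutator_mul_commutator ha hb
  have hs : aeval u (X * (X - C (α + β)) * Y) = z * z := by
    rw [hzz, map_mul, map_mul, map_sub, aeval_X, aeval_C]
  rw [hs] at hinj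
  have haw : Commute a w := commute_left_mul ha hb
  have haT : Commute a T := by
    rw [hTw]; exact haw.add_right (Algebra.commutes _ a).symm
  have haba : a * b * a = T * a := by rw [hTw]; exact mul_mul_self_eq ha hb
  have haz : a * z = α • z - z * a := mul_commutator ha
  have hazz : Commute a (z * z) := by rw [hzz]; exact haw.mul_right haT
  have hzinj : ∀ x, z x = 0 → x = 0 := fun x hx => hinj x (by rw [End.mul_apply, hx, map_zero])
  have hrange : ∀ x, x ∈ range a ↔ a x = α • x := fun x => by
    constructor
    · rintro ⟨y, rfl⟩
      rw [← End.mul_apply, ha, LinearMap.smul_apply]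
    · intro hx
      exact ⟨α⁻¹ • x, by rw [map_smul, hx, inv_smul_smul₀ hα]⟩
  have hz1 : ∀ x, a x = 0 → a (z x) = α • z x := fun x hx => by
    rw [← End.mul_apply, haz, LinearMap.sub_apply, LinearMap.smul_apply, End.mul_apply, hx,
      map_zero, sub_zero]
  have hz2 : ∀ x, a x = α • x → a (z x) = 0 := fun x hx => by
    rw [← End.mul_apply, haz, LinearMap.sub_apply, LinearMap.smul_apply, End.mul_apply, hx,
      map_smul, sub_self]
  have hT1 : ∀ x ∈ range a, T x ∈ range a := fun x hx => by
    rw [hrange] at hx ⊢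
    rw [← End.mul_apply, haT.eq, End.mul_apply, hx, map_smul]
  -- `z` is injective and maps `ker a` into `range a` and conversely, so both have the same
  -- dimension.
  have hdim : finrank K E = 2 * finrank K (range a) := by
    have h1 : finrank K (ker a) ≤ finrank K (range a) :=
      finrank_le_finrank_of_injective
        (f := z.restrict (p := ker a) (q := range a) fun x hx => (hrange _).2 (hz1 x hx))
        (by
          rw [← ker_eq_bot, ker_eq_bot']
          exact fun x hx => Subtype.ext (hzinj x (congrArg Subtype.val hx)))
    have h2 : finrank K (range a) ≤ finrank K (ker a) :=
      finrank_le_finrank_of_injective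
        (f := z.restrict (p := range a) (q := ker a) fun x hx => hz2 x ((hrange _).1 hx))
        (by
          rw [← ker_eq_bot, ker_eq_bot']
          exact fun x hx => Subtype.ext (hzinj x (congrArg Subtype.val hx)))
    have h3 := finrank_range_add_finrank_ker a
    omega
  let T₁ : End K (range a) := T.restrict hT1
  obtain ⟨N, x, R, hx, hRpos, hRdvd⟩ := exists_isCyclicDecomp_dvd (K := K) (M := AEval' T₁)
  let j : AEval' T₁ →ₗ[K] AEval' u :=
    (AEval'.of u).toLinearMap ∘ₗ (range a).subtype ∘ₗ (AEval'.of T₁).symm.toLinearMap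
  have hj : ∀ m, j ((X : K[X]) • m) = Y • j m := fun m => by
    obtain ⟨y, rfl⟩ := (AEval'.of T₁).surjective m
    rw [AEval'.X_smul_of]
    rfl
  have hjf := map_smul_eq_comp_smul j hj
  have hYdeg : Y.natDegree = 2 := by
    rw [hY, (monic_X_sub_C α).natDegree_mul (monic_X_sub_C β), natDegree_X_sub_C,
      natDegree_X_sub_C]
  have hYm : Y.Monic := (monic_X_sub_C α).mul (monic_X_sub_C β)
  have hdecomp : IsCyclicDecomp (M := AEval' u) (fun i => j (x i)) fun i => (R i).comp Y := by
    refine ⟨fun i => (hx.monic i).comp hYm (by omega), fun i => ?_, ?_, ?_⟩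
    · rw [← hjf, hx.smul_eq_zero, map_zero]
    · set S := Submodule.span K[X] (Set.range fun i => j (x i)) with hS
      have h1 : ∀ m, j m ∈ S := fun m => by
        have hm : m ∈ Submodule.span K[X] (Set.range x) := hx.span_eq_top ▸ trivial
        induction hm using Submodule.span_induction with
        | mem m hm =>
          obtain ⟨i, rfl⟩ := hm
          exact Submodule.subset_span ⟨i, rfl⟩
        | zero => rw [map_zero]; exact S.zero_mem
        | add m m' _ _ hm hm' => rw [map_add]; exact S.add_mem hm hm'
        | smul f m _ hm => rw [hjf]; exact S.smul_mem _ hm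
      have h2 : ∀ y, a y = α • y → AEval'.of u y ∈ S := fun y hy =>
        h1 (AEval'.of T₁ ⟨y, (hrange y).2 hy⟩)
      -- On `range a`, `aba = Ta` gives `a (b y) = T y`, which makes `z y` a polynomial in `u`
      -- applied to `y`.
      have h3 : ∀ y, a y = α • y → AEval'.of u (z y) ∈ S := fun y hy => by
        have hay : a (b y) = T y := by
          have := congr_fun (congrArg DFunLike.coe haba) y
          simp only [End.mul_apply, hy, map_smul] at this
          exact smul_right_injective E hα this
        have : z y = T y - α • (u y - α • y) := by
          rw [hz, LinearMap.sub_apply, End.mul_apply, End.mul_apply, hay, hy, map_smul, hu,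
            LinearMap.add_apply, hy, add_sub_cancel_left]
        rw [this, map_sub, map_smul, map_sub, map_smul]
        have h4 : AEval'.of u (T y) = Y • AEval'.of u y := rfl
        have h5 : AEval'.of u (u y) = (X : K[X]) • AEval'.of u y := (AEval'.X_smul_of u y).symm
        rw [h4, h5]
        exact S.sub_mem (S.smul_mem _ (h2 y hy))
          (S.smul_of_tower_mem α (S.sub_mem (S.smul_mem _ (h2 y hy))
            (S.smul_of_tower_mem α (h2 y hy))))
      -- `z * z` is bijective and commutes with `a`, so each element of `ker a` is `z (z k)` with `z
      -- k` in `range a`.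
      have h6 : ∀ y, a y = 0 → AEval'.of u y ∈ S := fun y hy => by
        have hsurj : Function.Surjective (z * z : End K E) :=
          (LinearMap.injective_iff_surjective).1 ((injective_iff_map_eq_zero _).2 hinj)
        obtain ⟨k, rfl⟩ := hsurj y
        have hk : a k = 0 := hinj _ (by
          rw [← End.mul_apply, ← hazz.eq, End.mul_apply, hy])
        exact h3 (z k) (hz1 k hk)
      rw [eq_top_iff]
      rintro m -
      obtain ⟨y, rfl⟩ := (AEval'.of u).surjective m
      have hy : y = α⁻¹ • a y + (y - α⁻¹ • a y) := by abel
      have haa : a (a y) = α • a y := (hrange _).1 ⟨y, rfl⟩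
      rw [hy, map_add]
      refine S.add_mem (h2 _ ?_) (h6 _ ?_)
      · rw [map_smul, haa, smul_comm]
      · rw [map_sub, map_smul, haa, inv_smul_smul₀ hα, sub_self]
    · have h1 : finrank K (AEval' u) = finrank K E := (AEval'.of u).symm.finrank_eq
      have h2 : finrank K (AEval' T₁) = finrank K (range a) := (AEval'.of T₁).symm.finrank_eq
      rw [h1, hdim, ← h2, ← hx.sum_natDegree, Finset.mul_sum]
      refine Finset.sum_congr rfl fun i _ => ?_
      rw [natDegree_comp, hYdeg, mul_comm]
  refine ⟨N, fun i => (R i).comp Y, ⟨hdecomp.monic, fun i => ?_, fun i k hik => ?_,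
    hdecomp.nonempty_equiv⟩, fun i => ⟨R i, rfl⟩⟩
  · rw [natDegree_comp, hYdeg]
    have := hRpos i
    omega
  · obtain ⟨q, hq⟩ := hRdvd i k hik
    rw [hq, mul_comp]
    exact dvd_mul_right _ _

/-- `a` commutes with `s(u)`, because `s` is a polynomial in `X(X - α - β)`, but need not commute
with `Q(u)`. Stability of `ker Q(u)` comes from its being the image of `s(u) ^ n`, by coprimality of
`s` and `Q`. -/
theorem isComposite_restrictOff [FiniteDimensional K E] {α β : K} (hα : α ≠ 0) (hβ : β ≠ 0)
    {u : End K E} (h : IsComposite α β u) :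
    IsComposite α β (restrictOff u {0, α, β, α + β}) ∧
      ∀ x, aeval (restrictOff u {0, α, β, α + β})
        (X * (X - C (α + β)) * ((X - C α) * (X - C β))) x = 0 → x = 0 := by
  set S : Set K := {0, α, β, α + β} with hS
  set s : K[X] := X * (X - C (α + β)) * ((X - C α) * (X - C β)) with hs
  set Q := partOff S (minpoly K u) with hQ
  have hm0 : minpoly K u ≠ 0 := minpoly.ne_zero (Algebra.IsIntegral.isIntegral u)
  have hco : IsCoprime s Q := by
    have key : ∀ c ∈ S, IsCoprime (X - C c) Q := fun c hc =>
      isCoprime_X_sub_C_of_eval_ne_zero (partOff_eval_ne_zero hm0 hc)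
    have h0 := key 0 (by simp [hS])
    rw [C_0, sub_zero] at h0
    exact (h0.mul_left (key _ (by simp [hS]))).mul_left
      ((key α (by simp [hS])).mul_left (key β (by simp [hS])))
  obtain ⟨n, hn⟩ := exists_partIn_dvd_pow S (minpoly K u) (s := s) (by
    rintro c (rfl | rfl | rfl | rfl)
    · exact ⟨(X - C (α + β)) * ((X - C α) * (X - C β)), by rw [hs, C_0]; ring⟩
    · exact ⟨X * (X - C (c + β)) * (X - C β), by rw [hs]; ring⟩
    · exact ⟨X * (X - C (α + c)) * (X - C α), by rw [hs]; ring⟩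
    · exact ⟨X * ((X - C α) * (X - C β)), by rw [hs]; ring⟩)
  have hzero : aeval u (Q * s ^ n) = 0 := by
    rw [← minpoly.dvd_iff, ← partIn_mul_partOff S (minpoly K u), mul_comm]
    exact mul_dvd_mul_left _ hn
  obtain ⟨a, b, ha, hb, hab⟩ := (isComposite_iff hα hβ).1 h
  have has : Commute a (aeval u s) := by
    have h1 : aeval u s = (a + b) * (a + b - algebraMap K (End K E) (α + β)) *
        ((a + b) * (a + b - algebraMap K (End K E) (α + β)) +
          algebraMap K (End K E) (α * β)) := by
      have : s = X * (X - C (α + β)) * (X * (X - C (α + β)) + C (α * β)) := by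
        rw [hs, C_add, C_mul]; ring
      rw [this, ← hab]
      simp only [map_mul, map_add, map_sub, aeval_X, aeval_C]
    have h2 := commute_left_mul ha hb
    rw [h1]
    exact h2.mul_right (h2.add_right (Algebra.commutes _ a).symm)
  have hstab : ∀ {c : End K E}, Commute c (aeval u s) → ∀ x ∈ kerOff u S, c x ∈ kerOff u S := by
    intro c hc x hx
    rw [kerOff, mem_ker] at hx ⊢
    obtain ⟨r, t, hrt⟩ := hco.pow_left (m := n)
    have h1 : aeval u (s ^ n) (aeval u r x) = x := by
      have h2 : aeval u (r * s ^ n + t * Q) x = aeval u (1 : K[X]) x := by rw [hrt]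
      rw [map_add, map_mul (aeval u) t, LinearMap.add_apply, End.mul_apply, hx, map_zero, add_zero,
        mul_comm, map_mul, End.mul_apply, map_one, End.one_apply] at h2
      exact h2
    have hcn : Commute c (aeval u (s ^ n)) := by rw [map_pow]; exact hc.pow_right n
    rw [← h1, ← End.mul_apply c, hcn.eq, End.mul_apply, ← End.mul_apply, ← map_mul, hzero,
      LinearMap.zero_apply]
  have hsa := hstab has
  have hsb : ∀ x ∈ kerOff u S, b x ∈ kerOff u S := fun x hx => by
    have : b x = u x - a x := by rw [hab, LinearMap.add_apply, add_sub_cancel_left]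
    rw [this]
    exact Submodule.sub_mem _ (apply_mem_kerOff u S x hx) (hsa x hx)
  refine ⟨(isComposite_iff hα hβ).2 ⟨a.restrict hsa, b.restrict hsb, ?_, ?_, ?_⟩, fun x hx => ?_⟩
  · refine LinearMap.ext fun x => Subtype.ext ?_
    exact congr_fun (congrArg DFunLike.coe ha) x.1
  · refine LinearMap.ext fun x => Subtype.ext ?_
    exact congr_fun (congrArg DFunLike.coe hb) x.1
  · refine LinearMap.ext fun x => Subtype.ext ?_
    exact congr_fun (congrArg DFunLike.coe hab) x.1
  · have h1 : ∀ (f : K[X]) (x : kerOff u S), (aeval (restrictOff u S) f x : E) = aeval u f x := by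
      intro f x
      have h2 := map_smul_eq_comp_smul (Y := X)
        ((AEval'.of u).toLinearMap ∘ₗ (kerOff u S).subtype ∘ₗ
          (AEval'.of (restrictOff u S)).symm.toLinearMap) (fun m => by
            obtain ⟨y, rfl⟩ := (AEval'.of (restrictOff u S)).surjective m
            rw [AEval'.X_smul_of]
            exact (AEval'.X_smul_of u (y : E)).symm) f (AEval'.of (restrictOff u S) x)
      rw [comp_X] at h2
      exact h2
    refine Subtype.ext (eq_zero_of_isCoprime_aeval hco ?_ x.2)
    rw [← h1, hx, ZeroMemClass.coe_zero]

end Necessity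

end IdemComb

theorem theorem8 {K E : Type*} [Field K] [AddCommGroup E] [Module K E] [FiniteDimensional K E]
    (u : Module.End K E) (α β : K) (hα : α ≠ 0) (hβ : β ≠ 0) (hne : α ≠ β) (hne' : α ≠ -β) :
    IdemComb.IsComposite α β u ↔
      IdemComb.Intertwined (IdemComb.nker u 0) (IdemComb.nker u (α + β)) ∧
      IdemComb.Intertwined (IdemComb.nker u α) (IdemComb.nker u β) ∧
      ∃ (N : ℕ) (P : Fin N → K[X]),
        IdemComb.IsElementaryFactors (IdemComb.restrictOff u {0, α, β, α + β}) P ∧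
        ∀ i, IdemComb.IsPolynomialOf ((X - C α) * (X - C β)) (P i) := by
  have hd : α + β ≠ 0 := fun h => hne' (eq_neg_of_add_eq_zero_left h)
  constructor
  · intro h
    obtain ⟨h1, h2⟩ := IdemComb.isComposite_restrictOff hα hβ h
    exact ⟨IdemComb.intertwined_of_isComposite hα hβ hd h,
      IdemComb.intertwined_of_isComposite' hα hβ hne h,
      IdemComb.exists_elementaryFactors_of_isComposite hα hβ h1 h2⟩
  · rintro ⟨h0, h1, N, P, hP, hPY⟩
    exact IdemComb.isComposite_of_conditions hα hβ hne hd h0 h1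
      (IdemComb.isComposite_of_elementaryFactors hα hβ hd hP hPY)
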